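/- **Setting.** Let $F$ be a compact connected oriented surface, possibly with boundary. A *diagram* in $F$ is an embedded finite graph (closed components without vertices are allowed) whose vertices of valence $1$ are exactly its points on $\partial F$ and whose other vertices have valence $4$ and carry a decoration: classical (over/under), flat, virtual or singular. Diagrams are oriented or unoriented, and are considered up to isotopy fixed on $\partial F$. An *$n$-tangle* is a diagram in the disk $\mathbb D^2$ with $2n$ fixed end points. Let $A$ be a commutative ring. A *local move* is a pair $(T_1,T_2)$ where $T_1$ is an $n$-tangle and $T_2$ is an $A$-linear combination of $n$-tangles with the same boundary; it is applied to a diagram that meets some embedded disk in $T_1$ by replacing $T_1$ with $T_2$ there. A *knot theory* $\mathcal M'$ is a set of local moves. For a set $\mathscr D'$ of diagrams, the *skein module* $\mathscr S(\mathscr D'|\mathcal M')$ is the quotient of the free module $A[\mathscr D']$ by the relations that isotopic diagrams are equal and that a diagram equals the result of applying to it a move of $\mathcal M'$. Let $S$ be any set of oriented Reidemeister moves, for instance the set of all of them or any smaller set presenting the oriented classical knot theory. Let $\mathscr D$ be a set of oriented classical diagrams in $F$; two diagrams of $\mathscr D$ are *equivalent* if they are connected by isotopies and moves of $S$ through diagrams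 of $\mathscr D$. Let $\mathcal T_2$ be the set of isotopy classes of $2$-tangles, either unoriented, or oriented with the boundary directions of an oriented crossing. A *local transformation rule* $\tau$ assigns to every crossing $c$ of every $D\in\mathscr D$ an element $\tau(c)=\tau_D(c)\in A[\mathcal T_2]$ that is preserved by isotopies and by moves of $S$ between diagrams of $\mathscr D$ whenever the crossing survives. Its *functorial map* $f_\tau(D)$ is the linear combination of diagrams obtained by replacing simultaneously every crossing $c$ of $D$ by $\tau(c)$ and expanding multilinearly; the tangles are inserted according to the orientation of the strands at the crossing. Consider a Reidemeister move with $m$ crossings on its left side (decreasing for the first and second moves), and let $t\in A[\mathcal T_2]^m$. We say that $t$ *satisfies* the move with respect to $\mathcal M'$ if, after replacing the $i$-th crossing (and, in a third move, also the corresponding crossing on the right side) by $t_i$ for all $i$, the two sides of the move become equal in the skein module of tangles in the disk modulo $\mathcal M'$. This condition depends only on the shape of the move and not on its over/under information. Let $\Omega_{1r}(\mathcal M')$ and $\Omega_{1l}(\mathcal M')$ be the sets of elements satisfying the first move for a loop on the right, respectively left, of the strand. Let $\Omega_2(\mathcal M')$ be the set of pairs satisfying the second move of the oriented shape under consideration (parallel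 strands, or antiparallel strands with the bigon on the right, respectively left, of both). Let $\Omega_3(\mathcal M')$ be the set of triples satisfying the third move with the directions of the strands under consideration. **Theorem.** Let $\mathcal M'$ be a knot theory and $\mathscr D'$ a set of (oriented or unoriented) diagrams in $F$ which is closed under isotopy and under the moves of $\mathcal M'$ and their inverses, and let $\tau$ be a local transformation rule on $\mathscr D$ with $f_\tau(D)\in A[\mathscr D']$ for all $D\in\mathscr D$. Suppose that, for all moves of $S$ between diagrams of $\mathscr D$: 1. if the move removes a loop crossing $c$ (positive or negative) lying on the right, then $\tau(c)\in\Omega_{1r}(\mathcal M')$, and if the loop lies on the left, then $\tau(c)\in\Omega_{1l}(\mathcal M')$; 2. if the move is a second Reidemeister move on the crossings $c_1,c_2$, then $(\tau(c_1),\tau(c_2))\in\Omega_2(\mathcal M')$; 3. if the move is a third Reidemeister move on the crossings $c_1,c_2,c_3$, then $(\tau(c_1),\tau(c_2),\tau(c_3))\in\Omega_3(\mathcal M')$. Then the functorial map $f_\tau$ is invariant with respect to $\mathcal M'$: if $D_1,D_2\in\mathscr D$ are equivalent, then $f_\tau(D_1)=f_\tau(D_2)$ in $\mathscr S(\mathscr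 D'|\mathcal M')$. -/

import Mathlib

open Set Filter Topology
open scoped Manifold ContDiff

noncomputable section

namespace KnotDiagrams

/-! ### Oriented surfaces and embedded disks -/

/-- The oriented Euclidean plane. -/
abbrev Plane : Type := EuclideanSpace ℝ (Fin 2)

section Surfaces

variable {H : Type*} [TopologicalSpace H] (I : ModelWithCorners ℝ Plane H)
  (F : Type*) [TopologicalSpace F] [ChartedSpace H F]

/-- `F` is oriented: the distinguished charts `chartAt H x` form an oriented atlas, i.e. all changes
of coordinates between them have positive Jacobian determinant. -/
class OrientedSurface [IsManifold I 1 F] : Prop where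
  det_pos : ∀ x y z : F, z ∈ (chartAt H x).source → z ∈ (chartAt H y).source →
    0 < (tangentCoordChange I x y z).det

/-- An orientation preserving open smooth embedding of the plane into (the interior of) `F`. The
closed disk it parametrizes is the image of the closed unit ball; the rest of the plane is a collar
of this disk. -/
@[ext]
structure DiskChart where
  toFun : Plane → F
  isOpenEmbedding : IsOpenEmbedding toFun
  contMDiff : ContMDiff 𝓘(ℝ, Plane) I ∞ toFun
  interior : ∀ p, I.IsInteriorPoint (toFun p)
  det_pos : ∀ p, 0 < ContinuousLinearMap.det
    (show Plane →L[ℝ] Plane from mfderiv 𝓘(ℝ, Plane) I toFun p)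

instance : CoeFun (DiskChart I F) fun _ => Plane → F := ⟨DiskChart.toFun⟩

variable {I F}

/-- A disk inside a disk. -/
def DiskChart.comp (φ : DiskChart I F) (ψ : DiskChart 𝓘(ℝ, Plane) Plane) : DiskChart I F where
  toFun := fun p => φ (ψ p)
  isOpenEmbedding := φ.isOpenEmbedding.comp ψ.isOpenEmbedding
  contMDiff := φ.contMDiff.comp ψ.contMDiff
  interior := fun p => φ.interior (ψ p)
  det_pos := fun p => by
    have h1 : MDifferentiableAt 𝓘(ℝ, Plane) I φ (ψ p) :=
      (φ.contMDiff (ψ p)).mdifferentiableAt (by simp)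
    have h2 : MDifferentiableAt 𝓘(ℝ, Plane) 𝓘(ℝ, Plane) ψ p :=
      (ψ.contMDiff p).mdifferentiableAt (by simp)
    have h := mfderiv_comp (I := 𝓘(ℝ, Plane)) (I' := 𝓘(ℝ, Plane)) (I'' := I) p h1 h2
    have h3 := mul_pos (φ.det_pos (ψ p)) (ψ.det_pos p)
    have h4 : mfderiv 𝓘(ℝ, Plane) I (fun p => φ (ψ p)) p = _ := h
    rw [h4]
    have h5 : ∀ f g : Plane →L[ℝ] Plane, (f.comp g).det = f.det * g.det := fun f g =>
      LinearMap.det_comp (f : Plane →ₗ[ℝ] Plane) (g : Plane →ₗ[ℝ] Plane)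
    exact (h5 _ _).symm ▸ h3

end Surfaces

/-! ### Crossings and diagrams -/

/-- The decorations of a 4-valent vertex. The crossing is drawn on the two coordinate axes of a
disk; `classical true` means that the horizontal axis is the overpass and `classical false` that the
vertical axis is. If both axes are oriented in their positive directions, `classical true` is a
positive crossing and `classical false` is a negative one. -/
inductive CrossingType : Type
  | classical (positive : Bool)
  | flat
  | virtual
  | singular

/-- The same crossing, seen in a disk that has been turned by a right angle. -/
def CrossingType.turn : CrossingType → CrossingType
  | classical b => classical !b
  | flat => flat
  | virtual => virtual
  | singular => singular

/-- The union of the two coordinate axes. -/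
def cross : Set Plane := {p | p 0 = 0 ∨ p 1 = 0}

open Classical in
/-- The direction of the axes, both oriented in the positive direction: to a point `p ≠ 0` of
the cross we assign the germ at `p` of the part of its axis that comes after `p`.
If `o = false` the axes are not oriented (no germ is assigned). -/
def crossFwd (o : Bool) (p : Plane) : Filter Plane :=
  if o = true ∧ p 1 = 0 ∧ p 0 ≠ 0 then 𝓝[{q | q 1 = 0 ∧ p 0 < q 0}] p
  else if o = true ∧ p 0 = 0 ∧ p 1 ≠ 0 then 𝓝[{q | q 0 = 0 ∧ p 1 < q 1}] p
  else ⊥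

/-- A crossing in a surface: a small disk around the vertex together with a decoration. -/
@[ext]
structure Crossing {H : Type*} [TopologicalSpace H] (I : ModelWithCorners ℝ Plane H)
    (F : Type*) [TopologicalSpace F] [ChartedSpace H F] where
  chart : DiskChart I F
  type : CrossingType

/-- Transport of a crossing in the plane by a disk. -/
def Crossing.push {H : Type*} [TopologicalSpace H] {I : ModelWithCorners ℝ Plane H}
    {F : Type*} [TopologicalSpace F] [ChartedSpace H F]
    (c : Crossing 𝓘(ℝ, Plane) Plane) (β : DiskChart I F) : Crossing I F :=
  ⟨β.comp c.chart, c.type⟩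

/-- A tangle diagram in the surface `F`: a closed subset `carrier` which is an embedded graph with
vertices of valence `1` (exactly its points on `∂F`) and decorated vertices of valence `4` (the
centres of finitely many disjoint crossing disks); closed components without vertices are allowed.

`o = true` means that the diagram is oriented. An orientation is recorded by `fwd`: for every point
`x` inside an edge, `fwd x` is the germ at `x` of the half of the edge that comes after `x`.
The disk of a crossing of an oriented diagram is positioned so that both axes are directed
positively. If `o = false` the diagram is unoriented and `fwd` carries no information. -/
@[ext]
structure Diagram {H : Type*} [TopologicalSpace H] (I : ModelWithCorners ℝ Plane H)
    (F : Type*) [TopologicalSpace F] [ChartedSpace H F] (o : Bool) where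
  carrier : Set F
  crossings : Set (Crossing I F)
  fwd : F → Filter F
  isClosed_carrier : IsClosed carrier
  finite_crossings : crossings.Finite
  disjoint_crossings : ∀ c ∈ crossings, ∀ c' ∈ crossings, c ≠ c' →
    Disjoint (range c.chart) (range c'.chart)
  /-- near a vertex of valence `4` the diagram is a cross -/
  crossing_carrier : ∀ c ∈ crossings, ∀ p, c.chart p ∈ carrier ↔ p ∈ cross
  crossing_fwd : ∀ c ∈ crossings, ∀ p, fwd (c.chart p) = map c.chart (crossFwd o p)
  /-- near its other interior points the diagram is an (oriented) arc -/
  strand : ∀ x ∈ carrier, I.IsInteriorPoint x → (∀ c ∈ crossings, x ≠ c.chart 0) →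
    ∃ e : OpenPartialHomeomorph F Plane, x ∈ e.source ∧ ∀ y ∈ e.source,
      (y ∈ carrier ↔ e y 1 = 0) ∧
      (y ∈ carrier → o = true → fwd y = 𝓝[{z | e z 1 = 0 ∧ e y 0 < e z 0}] y)
  /-- near its boundary points the diagram is an arc transversal to the boundary -/
  endpoint : ∀ x ∈ carrier, I.IsBoundaryPoint x →
    ∃ e : OpenPartialHomeomorph F (EuclideanHalfSpace 2), x ∈ e.source ∧ (e x).1 0 = 0 ∧
      ∀ y ∈ e.source, y ∈ carrier ↔ (e y).1 1 = 0
  fwd_eq_bot : ∀ x, x ∉ carrier ∨ I.IsBoundaryPoint x ∨ o = false → fwd x = ⊥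

/-- Diagrams in the plane. -/
abbrev PlaneDiagram (o : Bool) : Type := Diagram 𝓘(ℝ, Plane) Plane o

section Diagrams

variable {H : Type*} [TopologicalSpace H] {I : ModelWithCorners ℝ Plane H}
  {F : Type*} [TopologicalSpace F] [ChartedSpace H F] {o : Bool}

/-- An oriented diagram, considered as an oriented (`o = true`) or as an unoriented (`o = false`)
diagram. -/
def Diagram.relax (D : Diagram I F true) : (o : Bool) → Diagram I F o
  | true => D
  | false =>
    { carrier := D.carrier
      crossings := D.crossings
      fwd := fun _ => ⊥
      isClosed_carrier := D.isClosed_carrier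
      finite_crossings := D.finite_crossings
      disjoint_crossings := D.disjoint_crossings
      crossing_carrier := D.crossing_carrier
      crossing_fwd := fun c _ p => by simp [crossFwd]
      strand := fun x hx hi hv => by
        obtain ⟨e, hxe, he⟩ := D.strand x hx hi hv
        exact ⟨e, hxe, fun y hy => ⟨(he y hy).1, fun _ h => by simp at h⟩⟩
      endpoint := D.endpoint
      fwd_eq_bot := fun _ _ => rfl }

/-! ### Gluing diagrams of the plane into disks of a surface -/

/-- The union of the closed disks parametrized by a family of charts. -/
def diskUnion {ι : Type*} (φ : ι → DiskChart I F) : Set F :=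
  {x | ∃ i p, ‖p‖ ≤ 1 ∧ φ i p = x}

/-- The conditions under which the closed disks parametrized by `φ i` can be cut out of `D` and
replaced by the contents of the unit ball in the plane diagrams `T i`: the disks have disjoint
collars, `D` looks like `T i` in the collar of the `i`-th disk, and every crossing of `D` either
lies inside one of the disks or is away from all of them. -/
structure Patchable {ι : Type*} (D : Diagram I F o) (φ : ι → DiskChart I F)
    (T : ι → PlaneDiagram o) : Prop where
  disjoint : ∀ i j, i ≠ j → Disjoint (range (φ i)) (range (φ j))
  carrier : ∀ i p, 1 ≤ ‖p‖ → (φ i p ∈ D.carrier ↔ p ∈ (T i).carrier)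
  fwd : ∀ i p, 1 < ‖p‖ → D.fwd (φ i p) = map (φ i) ((T i).fwd p)
  crossings : ∀ c ∈ D.crossings, (∀ i, Disjoint (range c.chart) (range (φ i))) ∨
    c.chart 0 ∈ diskUnion φ

open Classical in
/-- The direction field of the glued diagram. -/
def patchFwd {ι : Type*} (D : Diagram I F o) (φ : ι → DiskChart I F)
    (T : ι → PlaneDiagram o) (x : F) : Filter F :=
  if h : x ∈ diskUnion φ then
    map (φ h.choose) ((T h.choose).fwd h.choose_spec.choose) else D.fwd x

/-- The underlying set of the glued diagram. -/
def patchCarrier {ι : Type*} (D : Diagram I F o) (φ : ι → DiskChart I F)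
    (T : ι → PlaneDiagram o) : Set F :=
  {x | (∃ i p, ‖p‖ ≤ 1 ∧ φ i p = x ∧ p ∈ (T i).carrier) ∨ (x ∈ D.carrier ∧ x ∉ diskUnion φ)}

section Patch

variable {ι : Type*} {D : Diagram I F o} {φ : ι → DiskChart I F} {T : ι → PlaneDiagram o}

theorem Patchable.eq_of_eq (h : Patchable D φ T) {i j : ι} {p q : Plane} (e : φ i p = φ j q) :
    i = j ∧ p = q := by
  have hij : i = j := by
    by_contra hne
    exact Set.disjoint_left.1 (h.disjoint i j hne) ⟨p, rfl⟩ ⟨q, e.symm⟩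
  subst hij
  exact ⟨rfl, (φ i).isOpenEmbedding.injective e⟩

theorem Patchable.mem_diskUnion (h : Patchable D φ T) {i : ι} {p : Plane} :
    φ i p ∈ diskUnion φ ↔ ‖p‖ ≤ 1 := by
  constructor
  · rintro ⟨j, q, hq, e⟩
    obtain ⟨-, rfl⟩ := h.eq_of_eq e
    exact hq
  · exact fun hp => ⟨i, p, hp, rfl⟩

theorem Patchable.mem_carrier (h : Patchable D φ T) (i : ι) (p : Plane) :
    φ i p ∈ patchCarrier D φ T ↔ p ∈ (T i).carrier := by
  constructor
  · rintro (⟨j, q, hq, e, hm⟩ | ⟨hD, hn⟩)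
    · obtain ⟨rfl, rfl⟩ := h.eq_of_eq e
      exact hm
    · rw [h.mem_diskUnion, not_le] at hn
      exact (h.carrier i p hn.le).1 hD
  · intro hp
    rcases le_or_gt ‖p‖ 1 with h1 | h1
    · exact Or.inl ⟨i, p, h1, rfl, hp⟩
    · exact Or.inr ⟨(h.carrier i p h1.le).2 hp, by rw [h.mem_diskUnion]; exact not_le.2 h1⟩

theorem mem_patchCarrier_of_notMem {x : F} (hx : x ∉ diskUnion φ) :
    x ∈ patchCarrier D φ T ↔ x ∈ D.carrier := by
  constructor
  · rintro (⟨j, q, hq, e, -⟩ | ⟨hD, -⟩)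
    · exact absurd ⟨j, q, hq, e⟩ hx
    · exact hD
  · exact fun hD => Or.inr ⟨hD, hx⟩

theorem Patchable.fwd_apply (h : Patchable D φ T) (i : ι) (p : Plane) :
    patchFwd D φ T (φ i p) = map (φ i) ((T i).fwd p) := by
  unfold patchFwd
  split_ifs with hx
  · obtain ⟨h1, h2⟩ := h.eq_of_eq hx.choose_spec.choose_spec.2
    generalize_proofs at h1 h2 ⊢
    rw [h2]
    generalize hx.choose = j at h1
    subst h1
    rfl
  · rw [h.mem_diskUnion, not_le] at hx
    exact h.fwd i p hx

theorem patchFwd_of_notMem {x : F} (hx : x ∉ diskUnion φ) : patchFwd D φ T x = D.fwd x := by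
  unfold patchFwd
  rw [dif_neg hx]

theorem isClosed_diskUnion [T2Space F] [Finite ι] : IsClosed (diskUnion φ) := by
  have : diskUnion φ = ⋃ i, φ i '' Metric.closedBall 0 1 := by
    ext x
    simp [diskUnion]
  rw [this]
  exact isClosed_iUnion_of_finite fun i =>
    ((isCompact_closedBall _ _).image (φ i).isOpenEmbedding.continuous).isClosed

/-- Cut the disks `φ i` out of `D` and glue in the plane diagrams `T i` instead. -/
def Diagram.patch [T2Space F] [Finite ι] (D : Diagram I F o) (φ : ι → DiskChart I F)
    (T : ι → PlaneDiagram o) (h : Patchable D φ T) : Diagram I F o where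
  carrier := patchCarrier D φ T
  crossings := {c | c ∈ D.crossings ∧ ∀ i, Disjoint (range c.chart) (range (φ i))} ∪
    ⋃ i, (fun c => c.push (φ i)) '' (T i).crossings
  fwd := patchFwd D φ T
  isClosed_carrier := by
    rw [← isOpen_compl_iff, isOpen_iff_mem_nhds]
    intro x hx
    by_cases hu : x ∈ diskUnion φ
    · obtain ⟨i, p, -, rfl⟩ := hu
      have hp : p ∈ (T i).carrierᶜ := fun hp => hx ((h.mem_carrier i p).2 hp)
      have hn : (T i).carrierᶜ ∈ 𝓝 p := (T i).isClosed_carrier.isOpen_compl.mem_nhds hp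
      have := (φ i).isOpenEmbedding.image_mem_nhds.2 hn
      refine mem_of_superset this ?_
      rintro _ ⟨q, hq, rfl⟩ hm
      exact hq ((h.mem_carrier i q).1 hm)
    · have hD : x ∈ D.carrierᶜ := fun hm => hx ((mem_patchCarrier_of_notMem hu).2 hm)
      filter_upwards [D.isClosed_carrier.isOpen_compl.mem_nhds hD,
        (isClosed_diskUnion (φ := φ)).isOpen_compl.mem_nhds hu] with y h1 h2 hm
      exact h1 ((mem_patchCarrier_of_notMem h2).1 hm)
  finite_crossings := (D.finite_crossings.subset fun c hc => hc.1).union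
    (finite_iUnion fun i => (T i).finite_crossings.image _)
  disjoint_crossings := by
    have key : ∀ (c : Crossing 𝓘(ℝ, Plane) Plane) (i : ι),
        range (c.push (φ i)).chart ⊆ range (φ i) := by
      rintro c i _ ⟨p, rfl⟩
      exact ⟨c.chart p, rfl⟩
    rintro c (⟨hc, hc'⟩ | hc) d (⟨hd, hd'⟩ | hd) hne
    · exact D.disjoint_crossings c hc d hd hne
    · obtain ⟨i, d, hdT, rfl⟩ := mem_iUnion.1 hd
      exact (hc' i).mono_right (key d i)
    · obtain ⟨i, c, hcT, rfl⟩ := mem_iUnion.1 hc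
      exact (hd' i).symm.mono_left (key c i)
    · obtain ⟨i, c, hcT, rfl⟩ := mem_iUnion.1 hc
      obtain ⟨j, d, hdT, rfl⟩ := mem_iUnion.1 hd
      by_cases hij : i = j
      · subst hij
        have hcd : c ≠ d := fun e => hne (by rw [e])
        have := (T i).disjoint_crossings c hcT d hdT hcd
        rw [Set.disjoint_left] at this ⊢
        rintro _ ⟨p, rfl⟩ ⟨q, hq⟩
        exact this ⟨p, rfl⟩ ⟨q, (φ i).isOpenEmbedding.injective hq⟩
      · exact (h.disjoint i j hij).mono (key c i) (key d j)
  crossing_carrier := by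
    rintro c (⟨hc, hc'⟩ | hc) p
    · have hn : c.chart p ∉ diskUnion φ := by
        rintro ⟨i, q, -, e⟩
        exact Set.disjoint_left.1 (hc' i) ⟨p, rfl⟩ ⟨q, e⟩
      rw [mem_patchCarrier_of_notMem hn]
      exact D.crossing_carrier c hc p
    · obtain ⟨i, c, hcT, rfl⟩ := mem_iUnion.1 hc
      exact (h.mem_carrier i (c.chart p)).trans ((T i).crossing_carrier c hcT p)
  crossing_fwd := by
    rintro c (⟨hc, hc'⟩ | hc) p
    · have hn : c.chart p ∉ diskUnion φ := by
        rintro ⟨i, q, -, e⟩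
        exact Set.disjoint_left.1 (hc' i) ⟨p, rfl⟩ ⟨q, e⟩
      rw [patchFwd_of_notMem hn]
      exact D.crossing_fwd c hc p
    · obtain ⟨i, c, hcT, rfl⟩ := mem_iUnion.1 hc
      exact (h.fwd_apply i (c.chart p)).trans
        (by rw [(T i).crossing_fwd c hcT p, Filter.map_map]; rfl)
  strand := by
    intro x hx hi hv
    by_cases hu : x ∈ diskUnion φ
    · obtain ⟨i, p, -, rfl⟩ := hu
      obtain ⟨e, hpe, he⟩ := (T i).strand p ((h.mem_carrier i p).1 hx)
        (by simp [ModelWithCorners.IsInteriorPoint])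
        (fun c hc hpc => hv (c.push (φ i))
          (Or.inr (mem_iUnion.2 ⟨i, c, hc, rfl⟩)) (congrArg (φ i) hpc))
      let g := (φ i).isOpenEmbedding.toOpenPartialHomeomorph (φ i)
      have hg : ∀ q, g.symm (φ i q) = q := fun q =>
        g.left_inv (by simp [g])
      refine ⟨g.symm.trans e, ?_, ?_⟩
      · rw [OpenPartialHomeomorph.trans_source]
        refine ⟨by simp [g], ?_⟩
        change g.symm (φ i p) ∈ e.source
        rw [hg]
        exact hpe
      · intro y hy
        rw [OpenPartialHomeomorph.trans_source] at hy
        obtain ⟨hy1, hy2⟩ := hy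
        have hy3 : y ∈ range (φ i) := by simpa [g] using hy1
        obtain ⟨q, rfl⟩ := hy3
        change g.symm (φ i q) ∈ e.source at hy2
        rw [hg] at hy2
        simp only [OpenPartialHomeomorph.coe_trans, Function.comp_apply, hg]
        refine ⟨(h.mem_carrier i q).trans (he q hy2).1, fun hm ho => ?_⟩
        rw [h.fwd_apply, (he q hy2).2 ((h.mem_carrier i q).1 hm) ho,
          (φ i).isOpenEmbedding.isInducing.map_nhdsWithin_eq]
        have hr : range (φ i) ∈ 𝓝 (φ i q) := (φ i).isOpenEmbedding.isOpen_range.mem_nhds ⟨q, rfl⟩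
        rw [← nhdsWithin_inter_of_mem' (s := {z | e (g.symm z) 1 = 0 ∧ e q 0 < e (g.symm z) 0})
          (mem_nhdsWithin_of_mem_nhds hr)]
        congr 1
        ext z
        constructor
        · rintro ⟨w, hw, rfl⟩
          refine ⟨?_, ⟨w, rfl⟩⟩
          change e (g.symm (φ i w)) 1 = 0 ∧ e q 0 < e (g.symm (φ i w)) 0
          rw [hg]
          exact hw
        · rintro ⟨hz, ⟨w, rfl⟩⟩
          change e (g.symm (φ i w)) 1 = 0 ∧ e q 0 < e (g.symm (φ i w)) 0 at hz
          rw [hg] at hz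
          exact ⟨w, hz, rfl⟩
    · obtain ⟨e, hxe, he⟩ := D.strand x ((mem_patchCarrier_of_notMem hu).1 hx) hi (by
        intro c hc hxc
        rcases h.crossings c hc with h1 | h1
        · exact hv c (Or.inl ⟨hc, h1⟩) hxc
        · exact hu (hxc ▸ h1))
      have ho : IsOpen (diskUnion φ)ᶜ := (isClosed_diskUnion (φ := φ)).isOpen_compl
      refine ⟨e.restrOpen _ ho, ⟨hxe, hu⟩, ?_⟩
      rintro y ⟨hy1, hy2⟩
      refine ⟨(mem_patchCarrier_of_notMem hy2).trans (he y hy1).1, fun hm hO => ?_⟩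
      rw [patchFwd_of_notMem hy2]
      exact (he y hy1).2 ((mem_patchCarrier_of_notMem hy2).1 hm) hO
  endpoint := by
    intro x hx hb
    have hu : x ∉ diskUnion φ := by
      rintro ⟨i, p, -, rfl⟩
      exact I.isInteriorPoint_iff_not_isBoundaryPoint _ |>.1 ((φ i).interior p) hb
    obtain ⟨e, hxe, h0, he⟩ := D.endpoint x ((mem_patchCarrier_of_notMem hu).1 hx) hb
    have ho : IsOpen (diskUnion φ)ᶜ := (isClosed_diskUnion (φ := φ)).isOpen_compl
    refine ⟨e.restrOpen _ ho, ⟨hxe, hu⟩, h0, ?_⟩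
    rintro y ⟨hy1, hy2⟩
    exact (mem_patchCarrier_of_notMem hy2).trans (he y hy1)
  fwd_eq_bot := by
    intro x hx
    by_cases hu : x ∈ diskUnion φ
    · obtain ⟨i, p, -, rfl⟩ := hu
      rw [h.fwd_apply, (T i).fwd_eq_bot p, Filter.map_bot]
      rcases hx with hx | hx | hx
      · exact Or.inl fun hp => hx ((h.mem_carrier i p).2 hp)
      · exact absurd hx (I.isInteriorPoint_iff_not_isBoundaryPoint _ |>.1 ((φ i).interior p))
      · exact Or.inr (Or.inr hx)
    · rw [patchFwd_of_notMem hu]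
      refine D.fwd_eq_bot x (hx.imp_left fun hx hm => hx ((mem_patchCarrier_of_notMem hu).2 hm))

end Patch

end Diagrams

/-! ### Tangles and substitution of tangles for crossings -/

/-- The `k`-th of the `2n` boundary points on the unit circle, enumerated counterclockwise. -/
def boundaryPoint (n : ℕ) (k : Fin (2 * n)) : Plane :=
  !₂[Real.cos (Real.pi * k / n), Real.sin (Real.pi * k / n)]

/-- An `n`-tangle in the unit disk is represented by a plane diagram that is standard outside of the
open disk: there it consists of `2n` radial rays, issuing from the boundary points. -/
structure Diagram.IsTangle {o : Bool} (T : PlaneDiagram o) (n : ℕ) : Prop where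
  carrier : ∀ p : Plane, 1 ≤ ‖p‖ →
    (p ∈ T.carrier ↔ ∃ k : Fin (2 * n), ∃ r : ℝ, 0 ≤ r ∧ p = r • boundaryPoint n k)
  crossings : ∀ c ∈ T.crossings, range c.chart ⊆ Metric.ball 0 1

/-- A `2`-tangle that can be substituted for a crossing: if `o = true` the tangle is oriented and
its boundary directions are those of an oriented crossing. -/
structure Tangle2 (o : Bool) where
  diagram : PlaneDiagram o
  isTangle : diagram.IsTangle 2
  fwd : ∀ p, 1 < ‖p‖ → diagram.fwd p = crossFwd o p

theorem exists_ray_iff_mem_cross (p : Plane) :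
    (∃ k : Fin (2 * 2), ∃ r : ℝ, 0 ≤ r ∧ p = r • boundaryPoint 2 k) ↔ p ∈ cross := by
  have e0 : boundaryPoint 2 0 = !₂[1, 0] := by simp [boundaryPoint]
  have e1 : boundaryPoint 2 1 = !₂[0, 1] := by simp [boundaryPoint]
  have e2 : boundaryPoint 2 2 = !₂[-1, 0] := by
    have : Real.pi * ((2 : Fin (2 * 2)) : ℕ) / (2 : ℕ) = Real.pi := by
      have : (((2 : Fin (2 * 2)) : ℕ) : ℝ) = 2 := by norm_num
      rw [this]; push_cast; ring
    unfold boundaryPoint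
    rw [this]; simp
  have e3 : boundaryPoint 2 3 = !₂[0, -1] := by
    have : Real.pi * ((3 : Fin (2 * 2)) : ℕ) / (2 : ℕ) = Real.pi / 2 + Real.pi := by
      have : (((3 : Fin (2 * 2)) : ℕ) : ℝ) = 3 := by norm_num
      rw [this]; push_cast; ring
    unfold boundaryPoint
    rw [this, Real.cos_add_pi, Real.sin_add_pi]; simp
  constructor
  · rintro ⟨k, r, -, rfl⟩
    fin_cases k
    · exact Or.inr (by change (r • boundaryPoint 2 0) 1 = 0; simp [e0])
    · exact Or.inl (by change (r • boundaryPoint 2 1) 0 = 0; simp [e1])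
    · exact Or.inr (by change (r • boundaryPoint 2 2) 1 = 0; simp [e2])
    · exact Or.inl (by change (r • boundaryPoint 2 3) 0 = 0; simp [e3])
  · rintro (h | h)
    · rcases le_total 0 (p 1) with h1 | h1
      · exact ⟨1, p 1, h1, by ext j; fin_cases j <;> simp [e1, h]⟩
      · exact ⟨3, -p 1, by linarith, by ext j; fin_cases j <;> simp [e3, h]⟩
    · rcases le_total 0 (p 0) with h1 | h1
      · exact ⟨0, p 0, h1, by ext j; fin_cases j <;> simp [e0, h]⟩
      · exact ⟨2, -p 0, by linarith, by ext j; fin_cases j <;> simp [e2, h]⟩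

section Substitution

variable {H : Type*} [TopologicalSpace H] {I : ModelWithCorners ℝ Plane H}
  {F : Type*} [TopologicalSpace F] [ChartedSpace H F] {o : Bool}

theorem relax_carrier (D : Diagram I F true) (o : Bool) : (D.relax o).carrier = D.carrier := by
  cases o <;> rfl

theorem relax_crossings (D : Diagram I F true) (o : Bool) :
    (D.relax o).crossings = D.crossings := by
  cases o <;> rfl

theorem patchable_crossings (D : Diagram I F true) (T : D.crossings → Tangle2 o) :
    Patchable (D.relax o) (fun c : D.crossings => c.1.chart) (fun c => (T c).diagram) where
  disjoint := fun c d h => D.disjoint_crossings c.1 c.2 d.1 d.2 fun e => h (Subtype.ext e)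
  carrier := fun c p hp => by
    rw [relax_carrier, D.crossing_carrier c.1 c.2, (T c).isTangle.carrier p hp,
      exists_ray_iff_mem_cross]
  fwd := fun c p hp => by
    rw [(D.relax o).crossing_fwd c.1 (by rw [relax_crossings]; exact c.2), (T c).fwd p hp]
  crossings := fun c hc => Or.inr
    ⟨⟨c, by rwa [relax_crossings] at hc⟩, 0, by simp, rfl⟩

/-- Replace all crossings `c` of an oriented diagram simultaneously by the `2`-tangles `T c`. -/
def Diagram.substitute [T2Space F] (D : Diagram I F true) (T : D.crossings → Tangle2 o) :
    Diagram I F o :=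
  haveI : Finite D.crossings := D.finite_crossings
  (D.relax o).patch (fun c : D.crossings => c.1.chart) (fun c => (T c).diagram)
    (patchable_crossings D T)

/-! ### Isotopy -/

/-- An ambient isotopy of `F` which is fixed on the set `Z`. -/
structure Isotopy (F : Type*) [TopologicalSpace F] (Z : Set F) where
  toFun : unitInterval → F ≃ₜ F
  continuous : Continuous fun q : unitInterval × F => toFun q.1 q.2
  zero : ∀ x, toFun 0 x = x
  fixed : ∀ t, ∀ x ∈ Z, toFun t x = x

/-- The final homeomorphism of an isotopy. -/
def Isotopy.final {Z : Set F} (Φ : Isotopy F Z) : F ≃ₜ F := Φ.toFun 1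

/-- Rotation of the plane by a right angle. -/
def quarterTurn (p : Plane) : Plane := !₂[-p 1, p 0]

/-- The homeomorphism `h` carries the crossing `c` to `c'`. The disks have to be matched on a
neighbourhood of the closed unit ball only. For unoriented diagrams the disk of a crossing may be
turned by right angles, provided that the decoration is turned along. -/
def Crossing.CarriedBy (o : Bool) (h : F ≃ₜ F) (c c' : Crossing I F) : Prop :=
  ∃ k : ℕ, (o = true → k = 0) ∧ c'.type = CrossingType.turn^[k] c.type ∧
    ∀ p, ‖p‖ ≤ 2 → c'.chart p = h (c.chart (quarterTurn^[k] p))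

/-- The homeomorphism `h` carries the diagram `D` to `D'`. -/
structure Diagram.CarriedBy (h : F ≃ₜ F) (D D' : Diagram I F o) : Prop where
  carrier : D'.carrier = h '' D.carrier
  fwd : ∀ x, D'.fwd (h x) = map h (D.fwd x)
  forth : ∀ c ∈ D.crossings, ∃ c' ∈ D'.crossings, c.CarriedBy o h c'
  back : ∀ c' ∈ D'.crossings, ∃ c ∈ D.crossings, c.CarriedBy o h c'

/-- `D` and `D'` are isotopic by an isotopy which is fixed on `Z`. -/
def Diagram.Isotopic (Z : Set F) (D D' : Diagram I F o) : Prop :=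
  ∃ Φ : Isotopy F Z, D.CarriedBy Φ.final D'

/-- The complement of the open unit disk. -/
def outside : Set Plane := {p | 1 ≤ ‖p‖}

/-- Isotopy classes (with fixed boundary) of `2`-tangles. -/
def Tangle2Class (o : Bool) : Type :=
  Quot fun S T : Tangle2 o => S.diagram.Isotopic outside T.diagram

/-! ### Local moves, knot theories and skein modules -/

/-- In the disk `β` the diagram `D` looks like `T`, and the other crossings are away from `β`. -/
structure Diagram.InDisk (D : Diagram I F o) (β : DiskChart I F) (T : PlaneDiagram o) : Prop where
  carrier : ∀ p, β p ∈ D.carrier ↔ p ∈ T.carrier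
  fwd : ∀ p, D.fwd (β p) = map β (T.fwd p)
  push_mem : ∀ c ∈ T.crossings, c.push β ∈ D.crossings
  crossings : ∀ c ∈ D.crossings, (∃ c' ∈ T.crossings, c = c'.push β) ∨
    Disjoint (range c.chart) (range β)

/-- `D'` is obtained from `D` by replacing the content `T` of the disk `β` by `T'`. -/
structure Replaces (β : DiskChart I F) (T T' : PlaneDiagram o) (D D' : Diagram I F o) : Prop where
  left : D.InDisk β T
  right : D'.InDisk β T'
  carrier : ∀ x, x ∉ range β → (x ∈ D.carrier ↔ x ∈ D'.carrier)
  fwd : ∀ x, x ∉ range β → D.fwd x = D'.fwd x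
  crossings : ∀ c : Crossing I F, Disjoint (range c.chart) (range β) →
    (c ∈ D.crossings ↔ c ∈ D'.crossings)

/-- A local move: an `n`-tangle and a linear combination of `n`-tangles with the same boundary. -/
structure LocalMove (A : Type*) [CommRing A] (o : Bool) where
  n : ℕ
  source : PlaneDiagram o
  target : PlaneDiagram o →₀ A
  source_isTangle : source.IsTangle n
  target_isTangle : ∀ T ∈ target.support, T.IsTangle n
  boundary : ∀ T ∈ target.support, ∀ p, 1 < ‖p‖ → T.fwd p = source.fwd p

/-- A knot theory, given by a set of local moves. -/
abbrev KnotTheory (A : Type*) [CommRing A] (o : Bool) : Type _ := Set (LocalMove A o)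

/-- The relations of the skein module of a set `𝒟` of diagrams: isotopic diagrams (with respect
to isotopies fixed on `Z`) are equal, and a diagram equals the linear combination obtained from it
by a local move inside a disk disjoint from `Z`. -/
def skeinRelations {A : Type*} [CommRing A] (Z : Set F) (𝒟 : Set (Diagram I F o))
    (M : KnotTheory A o) : Submodule A (Diagram I F o →₀ A) :=
  Submodule.span A
    ({x | ∃ D ∈ 𝒟, ∃ D' ∈ 𝒟, D.Isotopic Z D' ∧
        x = Finsupp.single D 1 - Finsupp.single D' 1} ∪
     {x | ∃ m ∈ M, ∃ β : DiskChart I F, Disjoint (range β) Z ∧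
        ∃ D ∈ 𝒟, D.InDisk β m.source ∧ ∃ R : PlaneDiagram o → Diagram I F o,
          (∀ T ∈ m.target.support, R T ∈ 𝒟 ∧ Replaces β m.source T D (R T)) ∧
          x = Finsupp.single D 1 - m.target.sum fun T a => Finsupp.single (R T) a})

/-- Equality in the skein module `A[𝒟] / skeinRelations`. -/
def SkeinEq {A : Type*} [CommRing A] (Z : Set F) (𝒟 : Set (Diagram I F o)) (M : KnotTheory A o)
    (x y : Diagram I F o →₀ A) : Prop :=
  (skeinRelations Z 𝒟 M).mkQ x = (skeinRelations Z 𝒟 M).mkQ y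

/-- `𝒟` is closed under isotopy and under the moves of `M` (in both directions), so that `M` is a
knot theory on the set of diagrams `𝒟`. -/
structure KnotTheory.IsOn {A : Type*} [CommRing A] (M : KnotTheory A o)
    (𝒟 : Set (Diagram I F o)) : Prop where
  isotopy : ∀ D D', D.Isotopic (I.boundary F) D' → (D ∈ 𝒟 ↔ D' ∈ 𝒟)
  move : ∀ m ∈ M, ∀ (β : DiskChart I F) (D D' : Diagram I F o), ∀ T ∈ m.target.support,
    Replaces β m.source T D D' → (D ∈ 𝒟 ↔ D' ∈ 𝒟)

/-! ### Functorial maps -/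

open Classical in
/-- The simultaneous replacement of all crossings `c` of `D` by the linear combinations `v c` of
(isotopy classes of) tangles, expanded multilinearly. -/
def replaceAll [T2Space F] {A : Type*} [CommRing A] (D : Diagram I F true)
    (v : Crossing I F → Tangle2Class o →₀ A) : Diagram I F o →₀ A :=
  haveI : Fintype D.crossings := D.finite_crossings.fintype
  ∑ s ∈ Fintype.piFinset fun c : D.crossings => (v c).support,
    Finsupp.single (D.substitute fun c => (s c).out) (∏ c : D.crossings, v c (s c))

end Substitution

/-! ### Oriented Reidemeister moves -/

/-- The end points of the arcs of an `n`-tangle with `m` crossings, cut at its crossings: the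
boundary points of the tangle and the four corners of every crossing. The corners are numbered
counterclockwise; at a crossing of an oriented diagram the horizontal strand enters at the corner
`2` and leaves at `0`, and the vertical strand enters at `3` and leaves at `1`. -/
abbrev Port (n m : ℕ) : Type := Fin (2 * n) ⊕ (Fin m × Fin 4)

/-- The position of a port of a tangle with crossings `κ`. -/
def portPosition {n m : ℕ} (κ : Fin m → Crossing 𝓘(ℝ, Plane) Plane) : Port n m → Plane
  | .inl k => boundaryPoint n k
  | .inr (i, k) => (κ i).chart (boundaryPoint 2 k)

/-- The part of a plane diagram that lies in the unit disk and outside of the crossing disks. -/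
def arcSet {m : ℕ} (K : PlaneDiagram true) (κ : Fin m → Crossing 𝓘(ℝ, Plane) Plane) : Set Plane :=
  {p | p ∈ K.carrier ∧ ‖p‖ ≤ 1 ∧ ∀ i, p ∉ (κ i).chart '' Metric.ball 0 1}

/-- `K` is an oriented classical `n`-tangle whose crossings, enumerated by `κ`, and boundary points
are connected by arcs as prescribed by the list `arcs` of pairs of ports, and which has no other
components. (In all cases used below every component of such a tangle reaches the boundary, hence
the tangle is determined up to isotopy by `arcs`, the types of the crossings, and the directions at
the boundary.) -/
structure Realizes {n m : ℕ} (arcs : List (Port n m × Port n m)) (K : PlaneDiagram true)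
    (κ : Fin m → Crossing 𝓘(ℝ, Plane) Plane) : Prop where
  isTangle : K.IsTangle n
  injective : Function.Injective κ
  crossings : K.crossings = range κ
  classical : ∀ i, ∃ b, (κ i).type = .classical b
  joined : ∀ a b : Port n m, JoinedIn (arcSet K κ) (portPosition κ a) (portPosition κ b) ↔
    a = b ∨ (a, b) ∈ arcs ∨ (b, a) ∈ arcs
  exhaust : ∀ p ∈ arcSet K κ, ∃ a : Port n m, JoinedIn (arcSet K κ) (portPosition κ a) p

/-- The shape of a Reidemeister move, without over/under information: the two sides of the move, and
for every crossing of the right side the crossing of the left side to which it corresponds. -/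
structure MoveShape where
  n : ℕ
  m : ℕ
  m' : ℕ
  left : List (Port n m × Port n m)
  right : List (Port n m' × Port n m')
  corr : Fin m' → Fin m

/-- The first Reidemeister move: a loop on the right hand side (`right = true`) or on the left hand
side of a strand is replaced by a strand without crossings. -/
def omega1Shape (right : Bool) : MoveShape where
  n := 1
  m := 1
  m' := 0
  left := if right then
      [(.inl 1, .inr (0, 2)), (.inr (0, 0), .inr (0, 3)), (.inr (0, 1), .inl 0)]
    else
      [(.inl 1, .inr (0, 3)), (.inr (0, 1), .inr (0, 2)), (.inr (0, 0), .inl 0)]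
  right := [(.inl 1, .inl 0)]
  corr := Fin.elim0

/-- The shapes of the second Reidemeister move: the two strands run in the same direction, or in
opposite directions with the bigon on the right or on the left hand side of both of them. -/
inductive Omega2Kind : Type
  | parallel
  | bigonRight
  | bigonLeft

/-- The second Reidemeister move. For parallel strands, the crossing `0` comes before the crossing
`1` on both strands. -/
def omega2Shape (kind : Omega2Kind) : MoveShape where
  n := 2
  m := 2
  m' := 0
  left := match kind with
    | .parallel =>
      [(.inl 2, .inr (0, 2)), (.inr (0, 0), .inr (1, 3)), (.inr (1, 1), .inl 1),
        (.inl 3, .inr (0, 3)), (.inr (0, 1), .inr (1, 2)), (.inr (1, 0), .inl 0)]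
    | .bigonRight =>
      [(.inl 2, .inr (0, 2)), (.inr (0, 0), .inr (1, 3)), (.inr (1, 1), .inl 3),
        (.inl 0, .inr (1, 2)), (.inr (1, 0), .inr (0, 3)), (.inr (0, 1), .inl 1)]
    | .bigonLeft =>
      [(.inl 3, .inr (0, 3)), (.inr (0, 1), .inr (1, 2)), (.inr (1, 0), .inl 2),
        (.inl 1, .inr (1, 3)), (.inr (1, 1), .inr (0, 2)), (.inr (0, 0), .inl 0)]
  right := match kind with
    | .parallel => [(.inl 2, .inl 1), (.inl 3, .inl 0)]
    | .bigonRight => [(.inl 2, .inl 3), (.inl 0, .inl 1)]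
    | .bigonLeft => [(.inl 3, .inl 2), (.inl 1, .inl 0)]
  corr := Fin.elim0

/-- Whether the strand `i` is the horizontal strand of the crossing `k` in a third Reidemeister
move. The three strands join the boundary points `i` and `i + 3`, `i = 0, 1, 2`; the strand `i`
is directed from `i` to `i + 3` if `d i = true`; the crossing `k` is that of the two strands
different from `k`. -/
def isHorizontal (d : Fin 3 → Bool) (i k : Fin 3) : Bool :=
  let j : Fin 3 := -(i + k)
  if i < j then d i == d j else d i != d j

/-- The corner at which the strand `i`, followed from the boundary point `i` to the boundary point
`i + 3`, arrives at the crossing `k`. -/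
def arrival (d : Fin 3 → Bool) (i k : Fin 3) : Fin 4 :=
  match isHorizontal d i k, d i with
  | true, true => 2
  | true, false => 0
  | false, true => 3
  | false, false => 1

/-- The corner at which the strand `i`, followed from the boundary point `i` to the boundary point
`i + 3`, departs from the crossing `k`. -/
def departure (d : Fin 3 → Bool) (i k : Fin 3) : Fin 4 := arrival d i k + 2

/-- The strand `i` passes the crossing `k` first and then the crossing `l`. -/
def strandArcs (d : Fin 3 → Bool) (i k l : Fin 3) : List (Port 3 3 × Port 3 3) :=
  [(.inl (i.castLE (by norm_num)), .inr (k, arrival d i k)),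
    (.inr (k, departure d i k), .inr (l, arrival d i l)),
    (.inr (l, departure d i l), .inl (i.natAdd 3))]

/-- The third Reidemeister move with directions of the strands given by `d`. -/
def omega3Shape (d : Fin 3 → Bool) : MoveShape where
  n := 3
  m := 3
  m' := 3
  left := strandArcs d 0 2 1 ++ strandArcs d 1 2 0 ++ strandArcs d 2 1 0
  right := strandArcs d 0 1 2 ++ strandArcs d 1 0 2 ++ strandArcs d 2 0 1
  corr := id

/-- The oriented Reidemeister moves.

* `omega1 right positive`: the loops of type `r₊`, `r₋`, `l₊`, `l₋`;
* `omega2 kind positive`: the crossing `0` has the given sign, the crossing `1` the opposite one;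
* `omega3 d height`: the strands have the directions `d`, and the strand `i` is above the
  strand `j` if `height j < height i`. -/
inductive ReidemeisterMove : Type
  | omega1 (right positive : Bool)
  | omega2 (kind : Omega2Kind) (positive : Bool)
  | omega3 (d : Fin 3 → Bool) (height : Equiv.Perm (Fin 3))

/-- The shape of a Reidemeister move. -/
def ReidemeisterMove.shape : ReidemeisterMove → MoveShape
  | omega1 right _ => omega1Shape right
  | omega2 kind _ => omega2Shape kind
  | omega3 d _ => omega3Shape d

/-- Whether the crossings of the left side of a Reidemeister move are positive. -/
def ReidemeisterMove.positive : (r : ReidemeisterMove) → Fin r.shape.m → Bool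
  | omega1 _ b => fun _ => b
  | omega2 _ b => ![b, !b]
  | omega3 d height => fun k : Fin 3 =>
    isHorizontal d (k + 1) k == decide (height (k + 2) < height (k + 1))

section Invariance

variable {H : Type*} [TopologicalSpace H] {I : ModelWithCorners ℝ Plane H}
  {F : Type*} [TopologicalSpace F] [ChartedSpace H F] {o : Bool}

/-- An application of a Reidemeister move that transforms `D` into `D'`. -/
structure MoveInstance (r : ReidemeisterMove) (D D' : Diagram I F true) where
  disk : DiskChart I F
  left : PlaneDiagram true
  leftCrossing : Fin r.shape.m → Crossing 𝓘(ℝ, Plane) Plane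
  right : PlaneDiagram true
  rightCrossing : Fin r.shape.m' → Crossing 𝓘(ℝ, Plane) Plane
  left_realizes : Realizes r.shape.left left leftCrossing
  right_realizes : Realizes r.shape.right right rightCrossing
  left_type : ∀ i, (leftCrossing i).type = .classical (r.positive i)
  right_type : ∀ j, (rightCrossing j).type = .classical (r.positive (r.shape.corr j))
  boundary : ∀ p, 1 < ‖p‖ → left.fwd p = right.fwd p
  replaces : Replaces disk left right D D'

/-- The `i`-th crossing of `D` that participates in the move. -/
def MoveInstance.crossing {r : ReidemeisterMove} {D D' : Diagram I F true}
    (μ : MoveInstance r D D') (i : Fin r.shape.m) : Crossing I F :=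
  (μ.leftCrossing i).push μ.disk

/-- The `j`-th crossing of `D'` that participates in the move. -/
def MoveInstance.crossing' {r : ReidemeisterMove} {D D' : Diagram I F true}
    (μ : MoveInstance r D D') (j : Fin r.shape.m') : Crossing I F :=
  (μ.rightCrossing j).push μ.disk

/-- All crossings are classical. -/
def Diagram.IsClassical (D : Diagram I F o) : Prop :=
  ∀ c ∈ D.crossings, ∃ b, c.type = .classical b

/-- The equivalence of diagrams in `𝒟` that is generated by isotopies (fixed on the boundary) and
by the Reidemeister moves in `S`. -/
def KnotEquiv (𝒟 : Set (Diagram I F true)) (S : Set ReidemeisterMove) :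
    Diagram I F true → Diagram I F true → Prop :=
  Relation.EqvGen fun D D' => D ∈ 𝒟 ∧ D' ∈ 𝒟 ∧
    (D.Isotopic (I.boundary F) D' ∨ ∃ r ∈ S, Nonempty (MoveInstance r D D'))

/-- A trait on the set `𝒟` of diagrams with values in `Θ`: a labelling of the crossings that is
preserved by isotopies and by the Reidemeister moves in `S`, whenever a crossing survives. -/
structure IsTrait {Θ : Type*} (𝒟 : Set (Diagram I F true)) (S : Set ReidemeisterMove)
    (τ : Diagram I F true → Crossing I F → Θ) : Prop where
  isotopy : ∀ D ∈ 𝒟, ∀ D' ∈ 𝒟, ∀ Φ : Isotopy F (I.boundary F), D.CarriedBy Φ.final D' →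
    ∀ c ∈ D.crossings, ∀ c' ∈ D'.crossings, c'.chart 0 = Φ.final (c.chart 0) → τ D c = τ D' c'
  away : ∀ D ∈ 𝒟, ∀ D' ∈ 𝒟, ∀ r ∈ S, ∀ μ : MoveInstance r D D',
    ∀ c ∈ D.crossings, Disjoint (range c.chart) (range μ.disk) → τ D c = τ D' c
  inside : ∀ D ∈ 𝒟, ∀ D' ∈ 𝒟, ∀ r ∈ S, ∀ μ : MoveInstance r D D',
    ∀ j, τ D (μ.crossing (r.shape.corr j)) = τ D' (μ.crossing' j)

variable {A : Type*} [CommRing A]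

/-- The tuples of linear combinations of `2`-tangles that satisfy a Reidemeister move of the given
shape with respect to the knot theory `M`: after substituting them for the crossings, both sides of
the move become equal in the skein module of `n`-tangles. -/
def reidemeisterTuples (sh : MoveShape) (M : KnotTheory A o) :
    Set (Fin sh.m → Tangle2Class o →₀ A) :=
  {t | ∀ K κ K' κ', Realizes sh.left K κ → Realizes sh.right K' κ' →
    (∀ p, 1 < ‖p‖ → K.fwd p = K'.fwd p) →
    SkeinEq outside {T : PlaneDiagram o | T.IsTangle sh.n} M
      (replaceAll K (Function.extend κ t 0)) (replaceAll K' (Function.extend κ' (t ∘ sh.corr) 0))}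

/-- The set `Ω₁ᵣ(M)`. -/
def Omega1r (M : KnotTheory A o) : Set (Tangle2Class o →₀ A) :=
  {a | (fun _ => a) ∈ reidemeisterTuples (omega1Shape true) M}

/-- The set `Ω₁ₗ(M)`. -/
def Omega1l (M : KnotTheory A o) : Set (Tangle2Class o →₀ A) :=
  {a | (fun _ => a) ∈ reidemeisterTuples (omega1Shape false) M}

/-- The set `Ω₂(M)`, for each of the shapes of the second Reidemeister move. -/
def Omega2 (kind : Omega2Kind) (M : KnotTheory A o) :
    Set ((Tangle2Class o →₀ A) × (Tangle2Class o →₀ A)) :=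
  {a | ![a.1, a.2] ∈ reidemeisterTuples (omega2Shape kind) M}

/-- The set `Ω₃(M)`, for given directions of the strands in the third Reidemeister move. -/
def Omega3 (d : Fin 3 → Bool) (M : KnotTheory A o) :
    Set ((Tangle2Class o →₀ A) × (Tangle2Class o →₀ A) × (Tangle2Class o →₀ A)) :=
  {a | ![a.1, a.2.1, a.2.2] ∈ reidemeisterTuples (omega3Shape d) M}

/-- The functorial map of a local transformation rule `τ`: every crossing `c` of `D` is replaced by
`τ_D(c)`. -/
def functorialMap [T2Space F] (τ : Diagram I F true → Crossing I F → Tangle2Class o →₀ A)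
    (D : Diagram I F true) : Diagram I F o →₀ A :=
  replaceAll D (τ D)

end Invariance

end KnotDiagrams

namespace KnotDiagrams

/-! ### Germs of directions and crossings of diagrams. -/

section General

variable {H : Type*} [TopologicalSpace H] {I : ModelWithCorners ℝ Plane H}
  {F : Type*} [TopologicalSpace F] [ChartedSpace H F] {o : Bool}

/-! A Reidemeister move changes a diagram only inside one disk, while the simultaneous replacement
of crossings is local and multilinear. Split the crossings into those inside the disk and those away
from it, and group the expansion of the functorial map by the tangles chosen for the outer
crossings. Each group is the image, under a linear insertion map, of the expansion of the tangle
inside the disk (`insert_substitute`, `replaceAll_eq_sum_insert`). The outer labels survive the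
move, so both sides of the move are obtained from their inner expansions by the same insertion maps
with the same coefficients. The hypothesis on the labels says that the difference of the two inner
expansions is a skein relation of tangles.

Insertion sends skein relations of tangles to skein relations of diagrams
(`linearCombination_insertVector_mem`): an isotopy fixed outside the unit disk extends by the
identity to the surface, and a move in a disk inside a disk is a move in the composite disk.
Isotopies of the original diagram are handled term by term, because the final homeomorphism matches
the crossing disks and hence carries one substituted diagram to the other
(`skeinEq_replaceAll_of_isotopic`).

The delicate point is membership in the set of admissible diagrams, which is known only for the
support of the functorial map. Different choices of tangles give different diagrams
(`substitute_injective`), so nothing cancels and every term with nonzero coefficient is admissible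
(`substitute_mem_support`). Insertions that are not admissible are sent to zero; this respects the
relations because admissibility is preserved by isotopies and by moves in both directions. -/

theorem crossFwd_zero (o : Bool) : crossFwd o 0 = ⊥ := by
  simp [crossFwd]

/-- The direction of a diagram at a point is a germ at this point. -/
theorem Diagram.fwd_le_nhds (D : Diagram I F o) (x : F) : D.fwd x ≤ 𝓝 x := by
  by_cases h : x ∉ D.carrier ∨ I.IsBoundaryPoint x ∨ o = false
  · rw [D.fwd_eq_bot x h]
    exact bot_le
  · push Not at h
    obtain ⟨hx, hb, ho⟩ := h
    have ho : o = true := by simpa using ho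
    by_cases hc : ∃ c ∈ D.crossings, x = c.chart 0
    -- A vertex has no strand chart, but the cross assigns the empty germ to its centre.
    · obtain ⟨c, hc, rfl⟩ := hc
      rw [D.crossing_fwd c hc, crossFwd_zero, Filter.map_bot]
      exact bot_le
    · push Not at hc
      obtain ⟨e, hxe, he⟩ :=
        D.strand x hx ((I.isInteriorPoint_iff_not_isBoundaryPoint x).2 hb) hc
      rw [(he x hxe).2 hx ho]
      exact nhdsWithin_le_nhds

/-- Forgetting the orientation makes both germs empty, so nothing is required of `f`. Taking `f =
id` transports plain equalities of germs. -/
theorem relax_fwd_congr {D D' : Diagram I F true} {x y : F} (f : F → F)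
    (h : D'.fwd y = map f (D.fwd x)) (o : Bool) :
    (D'.relax o).fwd y = map f ((D.relax o).fwd x) := by
  cases o
  · simp [Diagram.relax]
  · exact h

theorem Diagram.InDisk.relax {D : Diagram I F true} {β : DiskChart I F} {K : PlaneDiagram true}
    (h : D.InDisk β K) (o : Bool) : (D.relax o).InDisk β (K.relax o) := by
  cases o
  · exact ⟨h.carrier, fun p => by simp [Diagram.relax], h.push_mem, h.crossings⟩
  · exact h

theorem Diagram.eq_of_chart_eq (D : Diagram I F o) {c c' : Crossing I F} (hc : c ∈ D.crossings)
    (hc' : c' ∈ D.crossings) {p q : Plane} (h : c.chart p = c'.chart q) : c = c' := by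
  by_contra hne
  exact Set.disjoint_left.1 (D.disjoint_crossings c hc c' hc' hne) ⟨p, rfl⟩ ⟨q, h.symm⟩

theorem Crossing.push_injective (β : DiskChart I F) :
    Function.Injective fun c : Crossing 𝓘(ℝ, Plane) Plane => c.push β := by
  intro c c' h
  have h1 : β.comp c.chart = β.comp c'.chart := congrArg Crossing.chart h
  have h2 : (c.push β).type = (c'.push β).type := congrArg Crossing.type h
  refine Crossing.ext (DiskChart.ext (funext fun p => ?_)) h2
  exact β.isOpenEmbedding.injective (congrArg (fun ψ : DiskChart I F => ψ p) h1)

/-- A crossing of `D` survives the patch only if its disk misses all patched disks, which is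
impossible when its centre lies in one of them. Hence all crossings of the result come from the
inserted tangles. -/
theorem Patchable.patch_crossings [T2Space F] {ι : Type*} [Finite ι] {D : Diagram I F o}
    {φ : ι → DiskChart I F} {T : ι → PlaneDiagram o} (h : Patchable D φ T)
    (hc : ∀ c ∈ D.crossings, c.chart 0 ∈ diskUnion φ) (c : Crossing I F) :
    c ∈ (D.patch φ T h).crossings ↔ ∃ i, ∃ d ∈ (T i).crossings, c = d.push (φ i) := by
  constructor
  · rintro (⟨h1, h2⟩ | h1)
    · obtain ⟨i, p, -, e⟩ := hc c h1
      exact absurd ⟨p, e⟩ (Set.disjoint_left.1 (h2 i) ⟨0, rfl⟩)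
    · obtain ⟨i, d, hd, rfl⟩ := mem_iUnion.1 h1
      exact ⟨i, d, hd, rfl⟩
  · rintro ⟨i, d, hd, rfl⟩
    exact Or.inr (mem_iUnion.2 ⟨i, d, hd, rfl⟩)

/-! ### Substitution of tangles for crossings. -/

section Substitute

variable [T2Space F]

theorem substitute_mem_carrier (D : Diagram I F true) (T : D.crossings → Tangle2 o)
    (c : D.crossings) (p : Plane) :
    c.1.chart p ∈ (D.substitute T).carrier ↔ p ∈ (T c).diagram.carrier :=
  (patchable_crossings D T).mem_carrier c p

theorem substitute_mem_carrier_of_notMem (D : Diagram I F true) (T : D.crossings → Tangle2 o)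
    {x : F} (hx : x ∉ diskUnion fun c : D.crossings => c.1.chart) :
    x ∈ (D.substitute T).carrier ↔ x ∈ D.carrier := by
  rw [← relax_carrier D o]
  exact mem_patchCarrier_of_notMem hx

theorem substitute_fwd (D : Diagram I F true) (T : D.crossings → Tangle2 o)
    (c : D.crossings) (p : Plane) :
    (D.substitute T).fwd (c.1.chart p) = map c.1.chart ((T c).diagram.fwd p) :=
  (patchable_crossings D T).fwd_apply c p

theorem substitute_fwd_of_notMem (D : Diagram I F true) (T : D.crossings → Tangle2 o)
    {x : F} (hx : x ∉ diskUnion fun c : D.crossings => c.1.chart) :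
    (D.substitute T).fwd x = (D.relax o).fwd x :=
  patchFwd_of_notMem (D := D.relax o) (T := fun c => (T c).diagram) hx

theorem mem_substitute_crossings (D : Diagram I F true) (T : D.crossings → Tangle2 o)
    (c : Crossing I F) : c ∈ (D.substitute T).crossings ↔
      ∃ d : D.crossings, ∃ e ∈ (T d).diagram.crossings, c = e.push d.1.chart := by
  have : Finite D.crossings := D.finite_crossings
  refine (patchable_crossings D T).patch_crossings (fun c hc => ?_) c
  exact ⟨⟨c, by rwa [relax_crossings] at hc⟩, 0, by simp, rfl⟩

theorem Tangle2.ext_diagram {S T : Tangle2 o} (h : S.diagram = T.diagram) : S = T := by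
  cases S
  cases T
  cases h
  rfl

/-- The content of each crossing disk can be read back through its chart. This is what excludes
cancellation in the multilinear expansion. -/
theorem substitute_injective (D : Diagram I F true) :
    Function.Injective fun T : D.crossings → Tangle2 o => D.substitute T := by
  have key : ∀ S T : D.crossings → Tangle2 o, D.substitute S = D.substitute T →
      ∀ c : D.crossings, (S c).diagram.crossings ⊆ (T c).diagram.crossings := by
    intro S T h c e he
    have h1 : e.push c.1.chart ∈ (D.substitute S).crossings :=
      (mem_substitute_crossings D S _).2 ⟨c, e, he, rfl⟩
    rw [h, mem_substitute_crossings] at h1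
    obtain ⟨d, e', he', h2⟩ := h1
    -- The centre of the pushed crossing identifies its host disk, since distinct crossing disks are
    -- disjoint.
    have h3 : c.1.chart (e.chart 0) = d.1.chart (e'.chart 0) :=
      congrArg (fun k : Crossing I F => k.chart 0) h2
    obtain rfl : c = d := Subtype.ext (D.eq_of_chart_eq c.2 d.2 h3)
    rwa [Crossing.push_injective _ h2]
  intro S T h
  have h : D.substitute S = D.substitute T := h
  funext c
  refine Tangle2.ext_diagram (Diagram.ext ?_ ?_ ?_)
  · ext p
    rw [← substitute_mem_carrier D S c p, h, substitute_mem_carrier]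
  · exact (key S T h c).antisymm (key T S h.symm c)
  · funext p
    have h1 := substitute_fwd D S c p
    rw [h, substitute_fwd] at h1
    exact (Filter.map_injective c.1.chart.isOpenEmbedding.injective h1).symm

theorem Diagram.IsTangle.substitute {K : PlaneDiagram true} {n : ℕ} (hK : K.IsTangle n)
    (T : K.crossings → Tangle2 o) : (K.substitute T).IsTangle n where
  carrier := fun p hp => by
    rw [substitute_mem_carrier_of_notMem, hK.carrier p hp]
    rintro ⟨c, q, -, rfl⟩
    have := hK.crossings c.1 c.2 ⟨q, rfl⟩
    rw [mem_ball_zero_iff] at this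
    exact absurd hp (not_le.2 this)
  crossings := fun c hc => by
    obtain ⟨d, e, -, rfl⟩ := (mem_substitute_crossings K T c).1 hc
    rintro _ ⟨p, rfl⟩
    exact hK.crossings d.1 d.2 ⟨e.chart p, rfl⟩

theorem Diagram.IsTangle.substitute_fwd_eq {K : PlaneDiagram true} {n : ℕ} (hK : K.IsTangle n)
    (T : K.crossings → Tangle2 o) {p : Plane} (hp : 1 ≤ ‖p‖) :
    (K.substitute T).fwd p = (K.relax o).fwd p := by
  refine substitute_fwd_of_notMem K T ?_
  rintro ⟨c, q, -, rfl⟩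
  have := hK.crossings c.1 c.2 ⟨q, rfl⟩
  rw [mem_ball_zero_iff] at this
  exact absurd hp (not_le.2 this)

/-- Substitution of the same tangles for corresponding crossings commutes with homeomorphisms. -/
theorem Diagram.CarriedBy.substitute {h : F ≃ₜ F} {D D' : Diagram I F true}
    (hD : D.CarriedBy h D') (e : D.crossings ≃ D'.crossings)
    (he : ∀ c p, ‖p‖ ≤ 2 → (e c).1.chart p = h (c.1.chart p)) (T : D.crossings → Tangle2 o)
    (T' : D'.crossings → Tangle2 o) (hT : ∀ c, T' (e c) = T c) :
    (D.substitute T).CarriedBy h (D'.substitute T') := by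
  have hu : ∀ x, x ∉ diskUnion (fun c : D.crossings => c.1.chart) →
      h x ∉ diskUnion (fun c : D'.crossings => c.1.chart) := by
    rintro x hx ⟨c, p, hp, hxp⟩
    obtain ⟨c, rfl⟩ := e.surjective c
    refine hx ⟨c, p, hp, h.injective ?_⟩
    rw [← hxp]
    exact (he c p (by linarith)).symm
  have hmem : ∀ x, h x ∈ (D'.substitute T').carrier ↔ x ∈ (D.substitute T).carrier := by
    intro x
    by_cases hx : x ∈ diskUnion (fun c : D.crossings => c.1.chart)
    · obtain ⟨c, p, hp, rfl⟩ := hx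
      rw [← he c p (by linarith), substitute_mem_carrier, substitute_mem_carrier, hT]
    · rw [substitute_mem_carrier_of_notMem _ _ (hu x hx), substitute_mem_carrier_of_notMem _ _ hx,
        hD.carrier]
      exact h.injective.mem_set_image
  -- No quarter turn is needed, and the disk of `k` lies in the open unit ball, well inside the
  -- region where the charts are matched by `h`.
  have hcross : ∀ (c : D.crossings) (k : Crossing 𝓘(ℝ, Plane) Plane),
      k ∈ (T c).diagram.crossings →
        (k.push c.1.chart).CarriedBy o h (k.push (e c).1.chart) := by
    intro c k hk
    refine ⟨0, fun _ => rfl, rfl, fun p _ => he c _ ?_⟩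
    have := (T c).isTangle.crossings k hk ⟨p, rfl⟩
    rw [mem_ball_zero_iff] at this
    exact this.le.trans one_le_two
  refine ⟨?_, ?_, ?_, ?_⟩
  · ext y
    obtain ⟨x, rfl⟩ := h.surjective y
    rw [hmem, h.injective.mem_set_image]
  · intro x
    by_cases hx : x ∈ diskUnion (fun c : D.crossings => c.1.chart)
    · obtain ⟨c, p, hp, rfl⟩ := hx
      rw [← he c p (by linarith), substitute_fwd, substitute_fwd, hT, Filter.map_map]
      -- The charts are matched only up to radius `2`. As `‖p‖ ≤ 1`, this contains a neighbourhood
      -- of `p`, which suffices for germs at `p`; matching on the unit ball alone would not suffice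
      -- at its boundary.
      refine Filter.map_congr (Filter.Eventually.filter_mono ((T c).diagram.fwd_le_nhds p) ?_)
      have : Metric.ball (0 : Plane) 2 ∈ 𝓝 p :=
        Metric.isOpen_ball.mem_nhds (by rw [mem_ball_zero_iff]; linarith)
      filter_upwards [this] with q hq
      exact he c q (mem_ball_zero_iff.1 hq).le
    · rw [substitute_fwd_of_notMem _ _ (hu x hx), substitute_fwd_of_notMem _ _ hx]
      exact relax_fwd_congr h (hD.fwd x) o
  · intro c hc
    obtain ⟨d, k, hk, rfl⟩ := (mem_substitute_crossings D T c).1 hc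
    exact ⟨_, (mem_substitute_crossings D' T' _).2 ⟨e d, k, by rwa [hT], rfl⟩, hcross d k hk⟩
  · intro c hc
    obtain ⟨d, k, hk, rfl⟩ := (mem_substitute_crossings D' T' c).1 hc
    obtain ⟨d, rfl⟩ := e.surjective d
    rw [hT] at hk
    exact ⟨_, (mem_substitute_crossings D T _).2 ⟨d, k, hk, rfl⟩, hcross d k hk⟩

end Substitute

/-- A homeomorphism that carries an oriented diagram to another one induces a bijection of their
crossings. -/
theorem Diagram.CarriedBy.exists_equiv {h : F ≃ₜ F} {D D' : Diagram I F true}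
    (hD : D.CarriedBy h D') : ∃ e : D.crossings ≃ D'.crossings,
      ∀ c p, ‖p‖ ≤ 2 → (e c).1.chart p = h (c.1.chart p) := by
  -- Orientation excludes turned disks, so centres go to centres and a crossing is determined by its
  -- image.
  have key : ∀ c c' : Crossing I F, c.CarriedBy true h c' →
      ∀ p, ‖p‖ ≤ 2 → c'.chart p = h (c.chart p) := by
    rintro c c' ⟨k, hk, -, hc⟩ p hp
    obtain rfl := hk rfl
    exact hc p hp
  choose f hf hfc using hD.forth
  have h0 : ‖(0 : Plane)‖ ≤ 2 := by simp
  refine ⟨Equiv.ofBijective (fun c => ⟨f c.1 c.2, hf c.1 c.2⟩) ⟨fun c d hcd => ?_, fun d => ?_⟩,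
    fun c p hp => key _ _ (hfc c.1 c.2) p hp⟩
  · have h1 := key _ _ (hfc c.1 c.2) 0 h0
    have h2 := key _ _ (hfc d.1 d.2) 0 h0
    have h3 : f c.1 c.2 = f d.1 d.2 := congrArg Subtype.val hcd
    rw [h3] at h1
    exact Subtype.ext (D.eq_of_chart_eq c.2 d.2 (h.injective (h1.symm.trans h2)))
  · obtain ⟨c, hc, hcd⟩ := hD.back d.1 d.2
    refine ⟨⟨c, hc⟩, Subtype.ext (D'.eq_of_chart_eq (hf c hc) d.2 (p := 0) (q := 0) ?_)⟩
    rw [key _ _ (hfc c hc) 0 h0, key _ _ hcd 0 h0]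

end General

end KnotDiagrams

namespace KnotDiagrams

section Insert

variable {H : Type*} [TopologicalSpace H] {I : ModelWithCorners ℝ Plane H}
  {F : Type*} [TopologicalSpace F] [ChartedSpace H F] {o : Bool}

/-! ### Extension of isotopies of a disk -/

open Classical in
/-- The extension by the identity of a map of a disk. -/
def DiskChart.extend (β : DiskChart I F) (h : Plane → Plane) (x : F) : F :=
  if hx : x ∈ range β then β (h hx.choose) else x

theorem DiskChart.extend_apply (β : DiskChart I F) (h : Plane → Plane) (p : Plane) :
    β.extend h (β p) = β (h p) := by
  have hx : β p ∈ range β := ⟨p, rfl⟩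
  unfold DiskChart.extend
  rw [dif_pos hx, β.isOpenEmbedding.injective hx.choose_spec]

theorem DiskChart.extend_of_notMem (β : DiskChart I F) (h : Plane → Plane) {x : F}
    (hx : x ∉ range β) : β.extend h x = x := dif_neg hx

theorem DiskChart.isClosed_image [T2Space F] (β : DiskChart I F) :
    IsClosed (β '' Metric.closedBall 0 1) :=
  ((isCompact_closedBall _ _).image β.isOpenEmbedding.continuous).isClosed

/-- Two open sets cover the surface: the range of `β`, where the map is `g` read through an open
embedding, and the complement of the compact disk, where it is the projection. The parameter space
`X` is the time interval for isotopies and a point for single homeomorphisms. -/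
theorem DiskChart.continuous_extend [T2Space F] {X : Type*} [TopologicalSpace X]
    (β : DiskChart I F) (g : X → Plane → Plane) (hg : Continuous fun q : X × Plane => g q.1 q.2)
    (hfix : ∀ t p, 1 ≤ ‖p‖ → g t p = p) :
    Continuous fun q : X × F => β.extend (g q.1) q.2 := by
  rw [continuous_iff_continuousAt]
  rintro ⟨t, x⟩
  by_cases hx : x ∈ range β
  · obtain ⟨p, rfl⟩ := hx
    have hβ : IsOpenEmbedding (Prod.map (id : X → X) β) :=
      IsOpenEmbedding.id.prodMap β.isOpenEmbedding
    have h1 : ContinuousAt ((fun q : X × F => β.extend (g q.1) q.2) ∘ Prod.map id β) (t, p) := by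
      have : (fun q : X × F => β.extend (g q.1) q.2) ∘ Prod.map id β =
          fun q => β (g q.1 q.2) := funext fun q => β.extend_apply _ _
      rw [this]
      exact (β.isOpenEmbedding.continuous.comp hg).continuousAt
    exact hβ.continuousAt_iff.1 h1
  · have hx' : x ∈ (β '' Metric.closedBall 0 1)ᶜ := by
      rintro ⟨p, -, rfl⟩
      exact hx ⟨p, rfl⟩
    refine continuousAt_snd.congr ?_
    filter_upwards [continuousAt_snd.preimage_mem_nhds
      (β.isClosed_image.isOpen_compl.mem_nhds hx')] with q hq
    by_cases hq' : q.2 ∈ range β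
    · obtain ⟨p, hp⟩ := hq'
      rw [← hp, β.extend_apply, hfix]
      by_contra hlt
      exact hq ⟨p, by simpa using (not_le.1 hlt).le, hp⟩
    · rw [β.extend_of_notMem _ hq']

/-- The extension by the identity of a homeomorphism of a disk. -/
def DiskChart.extendHomeomorph [T2Space F] (β : DiskChart I F) (h : Plane ≃ₜ Plane)
    (hfix : ∀ p ∈ outside, h p = p) : F ≃ₜ F where
  toFun := β.extend h
  invFun := β.extend h.symm
  left_inv := fun x => by
    by_cases hx : x ∈ range β
    · obtain ⟨p, rfl⟩ := hx
      rw [β.extend_apply, β.extend_apply, h.symm_apply_apply]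
    · rw [β.extend_of_notMem _ hx, β.extend_of_notMem _ hx]
  right_inv := fun x => by
    by_cases hx : x ∈ range β
    · obtain ⟨p, rfl⟩ := hx
      rw [β.extend_apply, β.extend_apply, h.apply_symm_apply]
    · rw [β.extend_of_notMem _ hx, β.extend_of_notMem _ hx]
  continuous_toFun := by
    have := β.continuous_extend (X := Unit) (fun _ => h) (h.continuous.comp continuous_snd)
      fun _ p hp => hfix p hp
    exact this.comp (Continuous.prodMk_right ())
  continuous_invFun := by
    have := β.continuous_extend (X := Unit) (fun _ => h.symm)
      (h.symm.continuous.comp continuous_snd)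
      fun _ p hp => h.symm_apply_eq.2 (hfix p hp).symm
    exact this.comp (Continuous.prodMk_right ())

/-- The extension by the identity of an isotopy of a disk. -/
def Isotopy.extend [T2Space F] (Φ : Isotopy Plane outside) (β : DiskChart I F) {Z : Set F}
    (hZ : Disjoint (range β) Z) : Isotopy F Z where
  toFun := fun t => β.extendHomeomorph (Φ.toFun t) (Φ.fixed t)
  continuous := β.continuous_extend (fun t => Φ.toFun t) Φ.continuous Φ.fixed
  zero := fun x => by
    change β.extend (Φ.toFun 0) x = x
    by_cases hx : x ∈ range β
    · obtain ⟨p, rfl⟩ := hx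
      rw [β.extend_apply, Φ.zero]
    · exact β.extend_of_notMem _ hx
  fixed := fun t x hx => β.extend_of_notMem _ (Set.disjoint_right.1 hZ hx)

/-! ### Insertion of tangles -/

/-- The crossings of a diagram that are away from a disk. -/
def Diagram.outerCrossings (D : Diagram I F true) (β : DiskChart I F) : Set (Crossing I F) :=
  {c | c ∈ D.crossings ∧ Disjoint (range c.chart) (range β)}

/-- A disk together with the disks of the crossings away from it. -/
def insertCharts (D : Diagram I F true) (β : DiskChart I F) :
    Option (D.outerCrossings β) → DiskChart I F
  | none => β
  | some c => c.1.chart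

/-- The contents of a disk and of the disks of the crossings away from it. -/
def insertTangles {D : Diagram I F true} {β : DiskChart I F}
    (s : D.outerCrossings β → Tangle2 o) (T : PlaneDiagram o) :
    Option (D.outerCrossings β) → PlaneDiagram o
  | none => T
  | some c => (s c).diagram

/-- A diagram `T` that can be inserted in place of the tangle `K`. -/
structure Insertable (n : ℕ) (K : PlaneDiagram true) (T : PlaneDiagram o) : Prop where
  isTangle : T.IsTangle n
  fwd : ∀ p, 1 < ‖p‖ → T.fwd p = (K.relax o).fwd p

/-- Outside the open unit disk both `K` and `T` consist of the same standard rays, so `T` fits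
wherever `K` does. Each crossing of `D` is either pushed from `K`, with centre in the disk, or is
itself one of the outer crossings. -/
theorem patchable_insert {D : Diagram I F true} {β : DiskChart I F} {K : PlaneDiagram true} {n : ℕ}
    (hD : D.InDisk β K) (hK : K.IsTangle n) (s : D.outerCrossings β → Tangle2 o)
    {T : PlaneDiagram o} (hT : Insertable n K T) :
    Patchable (D.relax o) (insertCharts D β) (insertTangles s T) where
  disjoint := by
    rintro (_ | c) (_ | d) h
    · exact absurd rfl h
    · exact d.2.2.symm
    · exact c.2.2
    · exact D.disjoint_crossings c.1 c.2.1 d.1 d.2.1 fun e => h (congrArg some (Subtype.ext e))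
  carrier := by
    rintro (_ | c) p hp
    · change β p ∈ (D.relax o).carrier ↔ p ∈ T.carrier
      rw [relax_carrier, hD.carrier, hK.carrier p hp, hT.isTangle.carrier p hp]
    · change c.1.chart p ∈ (D.relax o).carrier ↔ p ∈ (s c).diagram.carrier
      rw [relax_carrier, D.crossing_carrier c.1 c.2.1, (s c).isTangle.carrier p hp,
        exists_ray_iff_mem_cross]
  fwd := by
    rintro (_ | c) p hp
    · change (D.relax o).fwd (β p) = map β (T.fwd p)
      rw [(hD.relax o).fwd, hT.fwd p hp]
    · change (D.relax o).fwd (c.1.chart p) = map c.1.chart ((s c).diagram.fwd p)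
      rw [(D.relax o).crossing_fwd c.1 (by rw [relax_crossings]; exact c.2.1), (s c).fwd p hp]
  crossings := by
    intro c hc
    rw [relax_crossings] at hc
    rcases hD.crossings c hc with ⟨k, hk, rfl⟩ | h
    · refine Or.inr ⟨none, k.chart 0, ?_, rfl⟩
      have := hK.crossings k hk ⟨0, rfl⟩
      exact (mem_ball_zero_iff.1 this).le
    · exact Or.inr ⟨some ⟨c, hc, h⟩, 0, by simp, rfl⟩

theorem finite_outerCrossings (D : Diagram I F true) (β : DiskChart I F) :
    Finite (D.outerCrossings β) :=
  D.finite_crossings.subset fun _ h => h.1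

theorem notMem_diskUnion_insertCharts {D : Diagram I F true} {β : DiskChart I F}
    {x : F} (hx : x ∉ range β)
    (hc : ∀ c : D.outerCrossings β, x ∉ range c.1.chart) : x ∉ diskUnion (insertCharts D β) := by
  rintro ⟨_ | c, p, -, h⟩
  · exact hx ⟨p, h⟩
  · exact hc c ⟨p, h⟩

theorem outerCrossings_push_disjoint {D : Diagram I F true} {β : DiskChart I F}
    (d : D.outerCrossings β) (k : Crossing 𝓘(ℝ, Plane) Plane) :
    Disjoint (range (k.push d.1.chart).chart) (range β) :=
  d.2.2.mono_left (by rintro _ ⟨p, rfl⟩; exact ⟨k.chart p, rfl⟩)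

theorem Crossing.CarriedBy.push {c c' : Crossing 𝓘(ℝ, Plane) Plane} {h : Plane ≃ₜ Plane}
    {β : DiskChart I F}
    (hc : c.CarriedBy o h c') {g : F ≃ₜ F} (hg : ∀ p, g (β p) = β (h p)) :
    (c.push β).CarriedBy o g (c'.push β) := by
  obtain ⟨k, h1, h2, h3⟩ := hc
  refine ⟨k, h1, h2, fun p hp => ?_⟩
  change β (c'.chart p) = g (β (c.chart _))
  rw [hg, h3 p hp]

theorem range_comp_subset (β : DiskChart I F) (γ : DiskChart 𝓘(ℝ, Plane) Plane) :
    range (β.comp γ) ⊆ range β := by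
  rintro _ ⟨p, rfl⟩
  exact ⟨γ p, rfl⟩

theorem disjoint_range_comp (β : DiskChart I F) {γ δ : DiskChart 𝓘(ℝ, Plane) Plane} :
    Disjoint (range (β.comp γ)) (range (β.comp δ)) ↔ Disjoint (range γ) (range δ) := by
  have h : ∀ γ : DiskChart 𝓘(ℝ, Plane) Plane, range (β.comp γ) = β '' range γ := fun γ =>
    range_comp β γ
  rw [h, h, Set.disjoint_image_iff β.isOpenEmbedding.injective]

/-- The strict inequality makes the final homeomorphism the identity on a whole neighbourhood of
`p`, so it fixes germs at `p` and not only the point. -/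
theorem Diagram.CarriedBy.fwd_eq_of_outside {T T' : PlaneDiagram o} {Φ : Isotopy Plane outside}
    (h : T.CarriedBy Φ.final T') {p : Plane} (hp : 1 < ‖p‖) : T'.fwd p = T.fwd p := by
  have h1 := h.fwd p
  have h2 : Φ.final p = p := Φ.fixed 1 p hp.le
  have h3 : ∀ᶠ q in 𝓝 p, Φ.final q = id q := by
    have : {q : Plane | 1 < ‖q‖} ∈ 𝓝 p :=
      (isOpen_lt continuous_const continuous_norm).mem_nhds hp
    filter_upwards [this] with q hq
    exact Φ.fixed 1 q hq.le
  rwa [h2, Filter.map_congr (h3.filter_mono (T.fwd_le_nhds p)), Filter.map_id] at h1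

variable [T2Space F]

/-- Replace the content of a disk by `T`, and substitute the tangles `s c` for the crossings away
from it. -/
def Diagram.insert {D : Diagram I F true} {β : DiskChart I F} {K : PlaneDiagram true} {n : ℕ}
    (hD : D.InDisk β K) (hK : K.IsTangle n) (s : D.outerCrossings β → Tangle2 o)
    {T : PlaneDiagram o} (hT : Insertable n K T) : Diagram I F o :=
  haveI := finite_outerCrossings D β
  (D.relax o).patch (insertCharts D β) (insertTangles s T) (patchable_insert hD hK s hT)

section

variable {D : Diagram I F true} {β : DiskChart I F} {K : PlaneDiagram true} {n : ℕ}
    (hD : D.InDisk β K) (hK : K.IsTangle n) (s : D.outerCrossings β → Tangle2 o)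
    {T : PlaneDiagram o} (hT : Insertable n K T)

theorem insert_mem_carrier (p : Plane) :
    β p ∈ (Diagram.insert hD hK s hT).carrier ↔ p ∈ T.carrier :=
  (patchable_insert hD hK s hT).mem_carrier none p

theorem insert_mem_carrier_outer (c : D.outerCrossings β) (p : Plane) :
    c.1.chart p ∈ (Diagram.insert hD hK s hT).carrier ↔ p ∈ (s c).diagram.carrier :=
  (patchable_insert hD hK s hT).mem_carrier (some c) p

theorem insert_fwd (p : Plane) :
    (Diagram.insert hD hK s hT).fwd (β p) = map β (T.fwd p) :=
  (patchable_insert hD hK s hT).fwd_apply none p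

theorem insert_fwd_outer (c : D.outerCrossings β) (p : Plane) :
    (Diagram.insert hD hK s hT).fwd (c.1.chart p) = map c.1.chart ((s c).diagram.fwd p) :=
  (patchable_insert hD hK s hT).fwd_apply (some c) p

theorem insert_mem_carrier_of_notMem {x : F} (hx : x ∉ range β)
    (hc : ∀ c : D.outerCrossings β, x ∉ range c.1.chart) :
    x ∈ (Diagram.insert hD hK s hT).carrier ↔ x ∈ D.carrier := by
  rw [← relax_carrier D o]
  exact mem_patchCarrier_of_notMem (notMem_diskUnion_insertCharts hx hc)

theorem insert_fwd_of_notMem {x : F} (hx : x ∉ range β)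
    (hc : ∀ c : D.outerCrossings β, x ∉ range c.1.chart) :
    (Diagram.insert hD hK s hT).fwd x = (D.relax o).fwd x :=
  patchFwd_of_notMem (D := D.relax o) (T := insertTangles s T)
    (notMem_diskUnion_insertCharts hx hc)

theorem mem_insert_crossings (c : Crossing I F) :
    c ∈ (Diagram.insert hD hK s hT).crossings ↔ (∃ k ∈ T.crossings, c = k.push β) ∨
      ∃ d : D.outerCrossings β, ∃ k ∈ (s d).diagram.crossings, c = k.push d.1.chart := by
  have := finite_outerCrossings D β
  refine ((patchable_insert hD hK s hT).patch_crossings (fun c hc => ?_) c).trans Option.exists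
  rw [relax_crossings] at hc
  rcases hD.crossings c hc with ⟨k, hk, rfl⟩ | h
  · refine ⟨none, k.chart 0, ?_, rfl⟩
    have := hK.crossings k hk ⟨0, rfl⟩
    exact (mem_ball_zero_iff.1 this).le
  · exact ⟨some ⟨c, hc, h⟩, 0, by simp, rfl⟩

variable {T' : PlaneDiagram o} (hT' : Insertable n K T')

/-- Off the disk, the inserted diagram depends only on `D` and on the tangles at the outer
crossings. -/
theorem insert_mem_carrier_congr {x : F} (hx : x ∉ range β) :
    x ∈ (Diagram.insert hD hK s hT).carrier ↔ x ∈ (Diagram.insert hD hK s hT').carrier := by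
  by_cases hc : ∃ c : D.outerCrossings β, x ∈ range c.1.chart
  · obtain ⟨c, p, rfl⟩ := hc
    rw [insert_mem_carrier_outer, insert_mem_carrier_outer]
  · push Not at hc
    rw [insert_mem_carrier_of_notMem _ _ _ _ hx hc, insert_mem_carrier_of_notMem _ _ _ _ hx hc]

theorem insert_fwd_congr {x : F} (hx : x ∉ range β) :
    (Diagram.insert hD hK s hT).fwd x = (Diagram.insert hD hK s hT').fwd x := by
  by_cases hc : ∃ c : D.outerCrossings β, x ∈ range c.1.chart
  · obtain ⟨c, p, rfl⟩ := hc
    rw [insert_fwd_outer, insert_fwd_outer]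
  · push Not at hc
    rw [insert_fwd_of_notMem _ _ _ _ hx hc, insert_fwd_of_notMem _ _ _ _ hx hc]

/-- Isotopic tangles can be inserted interchangeably. -/
theorem Diagram.Isotopic.insert (h : T.Isotopic outside T') {Z : Set F}
    (hZ : Disjoint (range β) Z) :
    (Diagram.insert hD hK s hT).Isotopic Z (Diagram.insert hD hK s hT') := by
  obtain ⟨Φ, hΦ⟩ := h
  refine ⟨Φ.extend β hZ, ?_⟩
  set g := (Φ.extend β hZ).final with hg
  have hgβ : ∀ p, g (β p) = β (Φ.final p) := fun p => β.extend_apply _ p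
  have hgn : ∀ x, x ∉ range β → g x = x := fun x hx => β.extend_of_notMem _ hx
  have hmem : ∀ x, g x ∈ (Diagram.insert hD hK s hT').carrier ↔
      x ∈ (Diagram.insert hD hK s hT).carrier := by
    intro x
    by_cases hx : x ∈ range β
    · obtain ⟨p, rfl⟩ := hx
      rw [hgβ, insert_mem_carrier, insert_mem_carrier, hΦ.carrier,
        Φ.final.injective.mem_set_image]
    · rw [hgn x hx, insert_mem_carrier_congr hD hK s hT' hT hx]
  have houter : ∀ (d : D.outerCrossings β) (k : Crossing 𝓘(ℝ, Plane) Plane),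
      (k.push d.1.chart).CarriedBy o g (k.push d.1.chart) := fun d k =>
    ⟨0, fun _ => rfl, rfl, fun p _ => (hgn _
      (Set.disjoint_left.1 (outerCrossings_push_disjoint d k) ⟨p, rfl⟩)).symm⟩
  refine ⟨?_, ?_, ?_, ?_⟩
  · ext y
    obtain ⟨x, rfl⟩ := g.surjective y
    rw [hmem, g.injective.mem_set_image]
  · intro x
    by_cases hx : x ∈ range β
    · obtain ⟨p, rfl⟩ := hx
      rw [hgβ, insert_fwd, insert_fwd, hΦ.fwd, Filter.map_map, Filter.map_map]
      exact congrArg (fun f => map f (T.fwd p)) (funext fun q => (hgβ q).symm)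
    · rw [hgn x hx, insert_fwd_congr hD hK s hT' hT hx]
      -- Equality of germs needs `g` to be the identity near `x`. It is the identity on the
      -- complement of the closed disk, which is open.
      by_cases hx' : x ∈ β '' Metric.closedBall 0 1
      · obtain ⟨p, -, rfl⟩ := hx'
        exact absurd ⟨p, rfl⟩ hx
      · have h1 : ∀ᶠ y in 𝓝 x, g y = id y := by
          filter_upwards [β.isClosed_image.isOpen_compl.mem_nhds hx'] with y hy
          by_cases hy' : y ∈ range β
          · obtain ⟨p, rfl⟩ := hy'
            rw [hgβ]
            refine congrArg β (Φ.fixed 1 p ?_)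
            by_contra hlt
            exact hy ⟨p, by simpa [outside] using (not_le.1 hlt).le, rfl⟩
          · exact hgn y hy'
        rw [Filter.map_congr (h1.filter_mono (Diagram.fwd_le_nhds _ x)), Filter.map_id]
  · intro c hc
    rcases (mem_insert_crossings hD hK s hT c).1 hc with ⟨k, hk, rfl⟩ | ⟨d, k, hk, rfl⟩
    · obtain ⟨k', hk', hkk⟩ := hΦ.forth k hk
      exact ⟨_, (mem_insert_crossings hD hK s hT' _).2 (Or.inl ⟨k', hk', rfl⟩), hkk.push hgβ⟩
    · exact ⟨_, (mem_insert_crossings hD hK s hT' _).2 (Or.inr ⟨d, k, hk, rfl⟩), houter d k⟩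
  · intro c hc
    rcases (mem_insert_crossings hD hK s hT' c).1 hc with ⟨k, hk, rfl⟩ | ⟨d, k, hk, rfl⟩
    · obtain ⟨k', hk', hkk⟩ := hΦ.back k hk
      exact ⟨_, (mem_insert_crossings hD hK s hT _).2 (Or.inl ⟨k', hk', rfl⟩), hkk.push hgβ⟩
    · exact ⟨_, (mem_insert_crossings hD hK s hT _).2 (Or.inr ⟨d, k, hk, rfl⟩), houter d k⟩

theorem Diagram.InDisk.insert {γ : DiskChart 𝓘(ℝ, Plane) Plane} {L : PlaneDiagram o}
    (h : T.InDisk γ L) : (Diagram.insert hD hK s hT).InDisk (β.comp γ) L where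
  carrier := fun p => (insert_mem_carrier hD hK s hT (γ p)).trans (h.carrier p)
  fwd := fun p => (insert_fwd hD hK s hT (γ p)).trans (by rw [h.fwd, Filter.map_map]; rfl)
  push_mem := fun c hc =>
    (mem_insert_crossings hD hK s hT _).2 (Or.inl ⟨_, h.push_mem c hc, rfl⟩)
  crossings := fun c hc => by
    rcases (mem_insert_crossings hD hK s hT c).1 hc with ⟨k, hk, rfl⟩ | ⟨d, k, hk, rfl⟩
    · rcases h.crossings k hk with ⟨l, hl, rfl⟩ | h1
      · exact Or.inl ⟨l, hl, rfl⟩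
      · exact Or.inr ((disjoint_range_comp β).2 h1)
    · exact Or.inr ((outerCrossings_push_disjoint d k).mono_right (range_comp_subset β γ))

/-- A replacement in a tangle can be performed after its insertion. -/
theorem Replaces.insert {γ : DiskChart 𝓘(ℝ, Plane) Plane} {L L' : PlaneDiagram o}
    (h : Replaces γ L L' T T') :
    Replaces (β.comp γ) L L' (Diagram.insert hD hK s hT) (Diagram.insert hD hK s hT') where
  left := Diagram.InDisk.insert hD hK s hT h.left
  right := Diagram.InDisk.insert hD hK s hT' h.right
  carrier := fun x hx => by
    by_cases hx' : x ∈ range β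
    · obtain ⟨p, rfl⟩ := hx'
      rw [insert_mem_carrier, insert_mem_carrier]
      exact h.carrier p fun ⟨q, hq⟩ => hx ⟨q, congrArg β hq⟩
    · exact insert_mem_carrier_congr hD hK s hT hT' hx'
  fwd := fun x hx => by
    by_cases hx' : x ∈ range β
    · obtain ⟨p, rfl⟩ := hx'
      rw [insert_fwd, insert_fwd, h.fwd p fun ⟨q, hq⟩ => hx ⟨q, congrArg β hq⟩]
    · exact insert_fwd_congr hD hK s hT hT' hx'
  crossings := fun c hc => by
    rw [mem_insert_crossings, mem_insert_crossings]
    refine or_congr_left (exists_congr fun k => and_congr_left ?_)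
    rintro rfl
    exact h.crossings k ((disjoint_range_comp β).1 hc)

/-- Insertability is invariant with respect to isotopy. -/
theorem Insertable.of_isotopic (hT : Insertable n K T) (h : T.Isotopic outside T')
    (hT' : T'.IsTangle n) : Insertable n K T' where
  isTangle := hT'
  fwd := fun p hp => by
    obtain ⟨Φ, hΦ⟩ := h
    rw [hΦ.fwd_eq_of_outside hp, hT.fwd p hp]

/-- Insertability is invariant with respect to replacements inside the unit disk. -/
theorem Insertable.of_replaces (hT : Insertable n K T) {γ : DiskChart 𝓘(ℝ, Plane) Plane}
    (hγ : Disjoint (range γ) outside) {L L' : PlaneDiagram o} (h : Replaces γ L L' T T')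
    (hT' : T'.IsTangle n) : Insertable n K T' where
  isTangle := hT'
  fwd := fun p hp => by
    rw [← h.fwd p (Set.disjoint_right.1 hγ (show p ∈ outside from hp.le)), hT.fwd p hp]

/-- The backward direction ensures that, if one target of a move can be inserted, its source can be
inserted too. -/
theorem Insertable.of_replaces' (hT' : Insertable n K T') {γ : DiskChart 𝓘(ℝ, Plane) Plane}
    (hγ : Disjoint (range γ) outside) {L L' : PlaneDiagram o} (h : Replaces γ L L' T T')
    (hT : T.IsTangle n) : Insertable n K T where
  isTangle := hT
  fwd := fun p hp => by
    rw [h.fwd p (Set.disjoint_right.1 hγ (show p ∈ outside from hp.le)), hT'.fwd p hp]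

/-- The substitution happens inside the open unit disk, so the boundary directions are still those
of `K'`, hence of `K`. Here `K'` may be `K` itself or the other side of a move. -/
theorem Insertable.substitute {K' : PlaneDiagram true} (hK' : K'.IsTangle n)
    (hKK' : ∀ p, 1 < ‖p‖ → K.fwd p = K'.fwd p) (u : K'.crossings → Tangle2 o) :
    Insertable n K (K'.substitute u) where
  isTangle := hK'.substitute u
  fwd := fun p hp => by
    rw [hK'.substitute_fwd_eq u hp.le]
    have := relax_fwd_congr (D := K) (D' := K') id (x := p) (y := p)
      (by rw [hKK' p hp, Filter.map_id]) o
    rw [this, Filter.map_id]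

end

end Insert

end KnotDiagrams

namespace KnotDiagrams

/-! ### Multilinear expansion of the functorial map. -/

section Expansion

variable {H : Type*} [TopologicalSpace H] {I : ModelWithCorners ℝ Plane H}
  {F : Type*} [TopologicalSpace F] [ChartedSpace H F] {o : Bool} {A : Type*} [CommRing A]

theorem skeinEq_iff {Z : Set F} {𝒟 : Set (Diagram I F o)} {M : KnotTheory A o}
    {x y : Diagram I F o →₀ A} : SkeinEq Z 𝒟 M x y ↔ x - y ∈ skeinRelations Z 𝒟 M := by
  unfold SkeinEq
  rw [Submodule.mkQ_apply, Submodule.mkQ_apply, Submodule.Quotient.eq]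

theorem Replaces.relax_fwd {β : DiskChart I F} {K K' : PlaneDiagram true} {D D' : Diagram I F true}
    (h : Replaces β K K' D D') {x : F} (hx : x ∉ range β) :
    (D.relax o).fwd x = (D'.relax o).fwd x := by
  have := relax_fwd_congr (D := D') (D' := D) id (x := x) (y := x)
    (by rw [h.fwd x hx, Filter.map_id]) o
  rw [this, Filter.map_id]

/-- The trivial replacement lets one expansion formula serve both sides of a move. -/
theorem Diagram.InDisk.replaces {β : DiskChart I F} {K : PlaneDiagram o} {D : Diagram I F o}
    (h : D.InDisk β K) : Replaces β K K D D :=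
  ⟨h, h, fun _ _ => Iff.rfl, fun _ _ => rfl, fun _ _ => Iff.rfl⟩

/-- The crossings of the result of a replacement are the old crossings away from the disk and the
crossings of the new content of the disk. -/
def Replaces.crossingsEquiv {β : DiskChart I F} {K K' : PlaneDiagram true}
    {D D' : Diagram I F true} (h : Replaces β K K' D D') :
    D.outerCrossings β ⊕ K'.crossings ≃ D'.crossings :=
  Equiv.ofBijective
    (Sum.elim (fun c => ⟨c.1, (h.crossings c.1 c.2.2).1 c.2.1⟩)
      (fun k => ⟨k.1.push β, h.right.push_mem k.1 k.2⟩)) (by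
    have key : ∀ (c : D.outerCrossings β) (k : K'.crossings), c.1 ≠ k.1.push β := fun c k e =>
      Set.disjoint_left.1 c.2.2 ⟨0, rfl⟩ (by rw [e]; exact ⟨k.1.chart 0, rfl⟩)
    constructor
    · rintro (c | c) (d | d) hcd
      · have hcd : c.1 = d.1 := (Subtype.ext_iff.1 hcd :)
        exact congrArg Sum.inl (Subtype.ext hcd)
      · exact absurd (Subtype.ext_iff.1 hcd) (key c d)
      · exact absurd (Subtype.ext_iff.1 hcd).symm (key d c)
      · have hcd : c.1.push β = d.1.push β := (Subtype.ext_iff.1 hcd :)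
        exact congrArg Sum.inr (Subtype.ext (Crossing.push_injective β hcd))
    · rintro ⟨c, hc⟩
      rcases h.right.crossings c hc with ⟨k, hk, rfl⟩ | hd
      · exact ⟨Sum.inr ⟨k, hk⟩, rfl⟩
      · exact ⟨Sum.inl ⟨c, (h.crossings c hd).2 hc, hd⟩, rfl⟩)

theorem DiskChart.disjoint_boundary (β : DiskChart I F) : Disjoint (range β) (I.boundary F) := by
  rw [Set.disjoint_left]
  rintro _ ⟨p, rfl⟩ hb
  exact (I.isInteriorPoint_iff_not_isBoundaryPoint _).1 (β.interior p) hb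

/-- The choices on the two parts of the index set are independent. This separates outer crossings
from inner ones in the expansion. -/
theorem sum_piFinset_sumElim {α β θ N : Type*} [Fintype α] [Fintype β] [DecidableEq α]
    [DecidableEq β] [AddCommMonoid N] (S : α ⊕ β → Finset θ) (f : (α ⊕ β → θ) → N) :
    ∑ s ∈ Fintype.piFinset S, f s = ∑ a ∈ Fintype.piFinset fun i => S (.inl i),
      ∑ b ∈ Fintype.piFinset fun j => S (.inr j), f (Sum.elim a b) := by
  rw [← Finset.sum_product']
  refine Finset.sum_nbij' (fun s => (fun i => s (.inl i), fun j => s (.inr j)))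
    (fun q => Sum.elim q.1 q.2) ?_ ?_ ?_ ?_ ?_
  · intro s hs
    rw [Fintype.mem_piFinset] at hs
    rw [Finset.mem_product, Fintype.mem_piFinset, Fintype.mem_piFinset]
    exact ⟨fun i => hs _, fun j => hs _⟩
  · intro q hq
    rw [Finset.mem_product, Fintype.mem_piFinset, Fintype.mem_piFinset] at hq
    rw [Fintype.mem_piFinset]
    rintro (i | j)
    · exact hq.1 i
    · exact hq.2 j
  · intro s _
    funext i
    cases i <;> rfl
  · intro q _
    rfl
  · intro s _
    congr 1
    funext i
    cases i <;> rfl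

variable [T2Space F]

/-- A free index type allows expansions of two diagrams to be summed over the same choices, and the
crossings to be indexed by a disjoint union. -/
theorem replaceAll_eq_sum (D : Diagram I F true) {ι : Type*} [Fintype ι] [DecidableEq ι]
    (e : ι ≃ D.crossings) (v : Crossing I F → Tangle2Class o →₀ A) :
    replaceAll D v = ∑ s ∈ Fintype.piFinset fun i => (v (e i)).support,
      Finsupp.single (D.substitute fun c => (s (e.symm c)).out) (∏ i, v (e i) (s i)) := by
  classical
  unfold replaceAll
  let _ : Fintype D.crossings := D.finite_crossings.fintype
  refine Finset.sum_nbij' (fun w i => w (e i)) (fun s c => s (e.symm c)) ?_ ?_ ?_ ?_ ?_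
  · intro w hw
    rw [Fintype.mem_piFinset] at hw ⊢
    exact fun i => hw (e i)
  · intro s hs
    rw [Fintype.mem_piFinset] at hs ⊢
    intro c
    have := hs (e.symm c)
    rwa [e.apply_symm_apply] at this
  · intro w _
    funext c
    exact congrArg w (e.apply_symm_apply c)
  · intro s _
    funext i
    exact congrArg s (e.symm_apply_apply i)
  · intro w _
    congr 1
    · congr 1
      funext c
      exact congrArg (fun d => (w d).out) (e.apply_symm_apply c).symm
    · exact (Fintype.prod_equiv e _ _ fun i => rfl).symm

theorem out_injective : Function.Injective fun t : Tangle2Class o => (t.out : Tangle2 o) := by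
  intro s t h
  have h : (s.out : Tangle2 o) = t.out := h
  rw [← Quot.out_eq s, ← Quot.out_eq t, h]

/-- No cancellation occurs in the simultaneous replacement of all crossings. -/
theorem substitute_mem_support (D : Diagram I F true) {ι : Type*} [Fintype ι]
    (e : ι ≃ D.crossings) (v : Crossing I F → Tangle2Class o →₀ A) (s : ι → Tangle2Class o)
    (hs : ∏ i, v (e i) (s i) ≠ 0) :
    D.substitute (fun c => (s (e.symm c)).out) ∈ (replaceAll D v).support := by
  classical
  -- Only the choice `s` contributes to this coefficient: another choice selects another
  -- representative somewhere, hence gives a different diagram.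
  rw [Finsupp.mem_support_iff, replaceAll_eq_sum D e v, Finsupp.finsetSum_apply,
    Finset.sum_eq_single s, Finsupp.single_eq_same]
  · exact hs
  · intro w _ hw
    refine Finsupp.single_eq_of_ne fun h => hw (funext fun i => ?_)
    have h1 := congrFun (substitute_injective D h) (e i)
    simp only [e.symm_apply_apply] at h1
    exact (out_injective h1).symm
  · intro h
    rw [Fintype.mem_piFinset] at h
    push Not at h
    obtain ⟨i, hi⟩ := h
    exact absurd (Finset.prod_eq_zero (f := fun i => v (e i) (s i)) (Finset.mem_univ i)
      (Finsupp.notMem_support_iff.1 hi)) hs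

/-- The functorial map is compatible with isotopy. -/
theorem skeinEq_replaceAll_of_isotopic {D D' : Diagram I F true} {Z : Set F} (Φ : Isotopy F Z)
    (hΦ : D.CarriedBy Φ.final D') {𝒟' : Set (Diagram I F o)} {M : KnotTheory A o}
    {v v' : Crossing I F → Tangle2Class o →₀ A}
    (hv : ∀ c ∈ D.crossings, ∀ c' ∈ D'.crossings, c'.chart 0 = Φ.final (c.chart 0) → v c = v' c')
    (h : ∀ E ∈ (replaceAll D v).support, E ∈ 𝒟') (h' : ∀ E ∈ (replaceAll D' v').support, E ∈ 𝒟') :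
    SkeinEq Z 𝒟' M (replaceAll D v) (replaceAll D' v') := by
  classical
  obtain ⟨e, he⟩ := hΦ.exists_equiv
  let _ : Fintype D.crossings := D.finite_crossings.fintype
  have hve : ∀ c, v' (e c) = v c := fun c =>
    (hv c.1 c.2 (e c).1 (e c).2 (he c 0 (by simp))).symm
  rw [skeinEq_iff, replaceAll_eq_sum D (Equiv.refl _) v, replaceAll_eq_sum D' e v']
  simp only [hve, Equiv.refl_apply, Equiv.refl_symm]
  rw [← Finset.sum_sub_distrib]
  refine Submodule.sum_mem _ fun s _ => ?_
  -- The ring may have zero divisors, so the product can vanish although every factor is nonzero.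
  -- Such a term need not be admissible, but contributes nothing.
  by_cases hs : ∏ c : D.crossings, v c (s c) = 0
  · rw [hs]
    simp
  · have h1 := h _ (substitute_mem_support D (Equiv.refl _) v s hs)
    have h2 := h' _ (substitute_mem_support D' e v' s (by simpa only [hve] using hs))
    have h3 : Finsupp.single (D.substitute fun c => (s c).out) (1 : A) -
        Finsupp.single (D'.substitute fun c => (s (e.symm c)).out) 1 ∈
          skeinRelations Z 𝒟' M := by
      refine Submodule.subset_span (Or.inl ⟨_, h1, _, h2, ⟨Φ, ?_⟩, rfl⟩)
      exact hΦ.substitute e he _ _ fun c => by rw [e.symm_apply_apply]; rfl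
    have h4 := Submodule.smul_mem _ (∏ c : D.crossings, v c (s c)) h3
    rw [smul_sub, Finsupp.smul_single_one, Finsupp.smul_single_one] at h4
    exact h4

/-- Substituting tangles for crossings inside a disk first gives the same result as substituting
them for all crossings at once. -/
theorem insert_substitute {β : DiskChart I F} {K K' : PlaneDiagram true} {D D' : Diagram I F true}
    (hR : Replaces β K K' D D') {n : ℕ} (hK : K.IsTangle n) (hK' : K'.IsTangle n)
    (hKK' : ∀ p, 1 < ‖p‖ → K.fwd p = K'.fwd p) (s : D.outerCrossings β → Tangle2 o)
    (u : K'.crossings → Tangle2 o) (w : D'.crossings → Tangle2 o)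
    (hw : ∀ x, w (hR.crossingsEquiv x) = Sum.elim s u x) :
    Diagram.insert hR.left hK s (Insertable.substitute hK' hKK' u) = D'.substitute w := by
  have hin : ∀ p, p ∉ diskUnion (fun k : K'.crossings => k.1.chart) →
      β p ∉ diskUnion (fun c : D'.crossings => c.1.chart) := by
    rintro p hp ⟨c, q, hq, h⟩
    obtain ⟨c | k, rfl⟩ := hR.crossingsEquiv.surjective c
    · exact Set.disjoint_left.1 c.2.2 ⟨q, h⟩ ⟨p, rfl⟩
    · exact hp ⟨k, q, hq, β.isOpenEmbedding.injective h⟩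
  have hout : ∀ x, x ∉ range β → (∀ c : D.outerCrossings β, x ∉ range c.1.chart) →
      x ∉ diskUnion (fun c : D'.crossings => c.1.chart) := by
    rintro x hx hc ⟨c, q, hq, h⟩
    obtain ⟨c | k, rfl⟩ := hR.crossingsEquiv.surjective c
    · exact hc c ⟨q, h⟩
    · exact hx ⟨k.1.chart q, h⟩
  -- The equality is literal, not up to isotopy. It is checked separately in the disk, in the outer
  -- crossing disks and elsewhere.
  refine Diagram.ext ?_ ?_ ?_
  · ext x
    by_cases hx : x ∈ range β
    · obtain ⟨p, rfl⟩ := hx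
      rw [insert_mem_carrier]
      by_cases hp : p ∈ diskUnion (fun k : K'.crossings => k.1.chart)
      · obtain ⟨k, q, -, rfl⟩ := hp
        have := substitute_mem_carrier D' w (hR.crossingsEquiv (.inr k)) q
        rw [hw] at this
        exact (substitute_mem_carrier K' u k q).trans this.symm
      · rw [substitute_mem_carrier_of_notMem _ _ hp,
          substitute_mem_carrier_of_notMem _ _ (hin p hp), hR.right.carrier]
    · by_cases hc : ∃ c : D.outerCrossings β, x ∈ range c.1.chart
      · obtain ⟨c, q, rfl⟩ := hc
        have := substitute_mem_carrier D' w (hR.crossingsEquiv (.inl c)) q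
        rw [hw] at this
        rw [insert_mem_carrier_outer]
        exact this.symm
      · push Not at hc
        rw [insert_mem_carrier_of_notMem _ _ _ _ hx hc,
          substitute_mem_carrier_of_notMem _ _ (hout x hx hc), hR.carrier x hx]
  -- Pushing a crossing through a crossing disk of `K'` and then through `β` is definitionally the
  -- push along the composite chart.
  · ext1 c
    rw [mem_insert_crossings, mem_substitute_crossings]
    constructor
    · rintro (⟨k, hk, rfl⟩ | ⟨d, k, hk, rfl⟩)
      · obtain ⟨d, l, hl, rfl⟩ := (mem_substitute_crossings K' u k).1 hk
        exact ⟨hR.crossingsEquiv (.inr d), l, by rw [hw]; exact hl, rfl⟩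
      · exact ⟨hR.crossingsEquiv (.inl d), k, by rw [hw]; exact hk, rfl⟩
    · rintro ⟨d, k, hk, rfl⟩
      obtain ⟨d | d, rfl⟩ := hR.crossingsEquiv.surjective d
      · rw [hw] at hk
        exact Or.inr ⟨d, k, hk, rfl⟩
      · rw [hw] at hk
        exact Or.inl ⟨k.push d.1.chart, (mem_substitute_crossings K' u _).2 ⟨d, k, hk, rfl⟩, rfl⟩
  · funext x
    by_cases hx : x ∈ range β
    · obtain ⟨p, rfl⟩ := hx
      rw [insert_fwd]
      by_cases hp : p ∈ diskUnion (fun k : K'.crossings => k.1.chart)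
      · obtain ⟨k, q, -, rfl⟩ := hp
        have := substitute_fwd D' w (hR.crossingsEquiv (.inr k)) q
        rw [hw] at this
        rw [substitute_fwd, Filter.map_map]
        exact this.symm
      · rw [substitute_fwd_of_notMem _ _ hp, substitute_fwd_of_notMem _ _ (hin p hp),
          (hR.right.relax o).fwd]
    · by_cases hc : ∃ c : D.outerCrossings β, x ∈ range c.1.chart
      · obtain ⟨c, q, rfl⟩ := hc
        have := substitute_fwd D' w (hR.crossingsEquiv (.inl c)) q
        rw [hw] at this
        rw [insert_fwd_outer]
        exact this.symm
      · push Not at hc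
        rw [insert_fwd_of_notMem _ _ _ _ hx hc, substitute_fwd_of_notMem _ _ (hout x hx hc),
          hR.relax_fwd hx]

/-! ### Insertion as a linear map compatible with skein relations. -/

section Linear

variable {D : Diagram I F true} {β : DiskChart I F} {K : PlaneDiagram true} {n : ℕ}
  (hD : D.InDisk β K) (hK : K.IsTangle n) (s : D.outerCrossings β → Tangle2 o)
  (𝒟' : Set (Diagram I F o))

open Classical in
/-- The result of the insertion of `T` into a disk, provided that it is defined and belongs to
`𝒟'`, and zero otherwise. -/
def insertVector (A : Type*) [CommRing A] (T : PlaneDiagram o) : Diagram I F o →₀ A :=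
  if h : ∃ hT : Insertable n K T, Diagram.insert hD hK s hT ∈ 𝒟' then
    Finsupp.single (Diagram.insert hD hK s h.fst) 1 else 0

variable {𝒟'}

theorem insertVector_of_mem {T : PlaneDiagram o} (hT : Insertable n K T)
    (h : Diagram.insert hD hK s hT ∈ 𝒟') :
    insertVector hD hK s 𝒟' A T = Finsupp.single (Diagram.insert hD hK s hT) 1 :=
  dif_pos ⟨hT, h⟩

theorem insertVector_of_notMem {T : PlaneDiagram o}
    (h : ∀ hT : Insertable n K T, Diagram.insert hD hK s hT ∉ 𝒟') :
    insertVector hD hK s 𝒟' A T = 0 :=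
  dif_neg fun ⟨hT, h'⟩ => h hT h'

/-- Insertion of linear combinations of tangles maps the skein relations of tangles to skein
relations of diagrams. -/
theorem linearCombination_insertVector_mem {M : KnotTheory A o} (hM : M.IsOn 𝒟')
    {x : PlaneDiagram o →₀ A} (hx : x ∈ skeinRelations outside {T | T.IsTangle n} M) :
    Finsupp.linearCombination A (insertVector hD hK s 𝒟' A) x ∈
      skeinRelations (I.boundary F) 𝒟' M := by
  classical
  -- By linearity it suffices to treat the two kinds of generators, isotopies and local moves.
  refine (Submodule.map_span_le _ _ _).2 ?_ (Submodule.mem_map_of_mem hx)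
  rintro x (⟨T, hT, T', hT', hTT', rfl⟩ | ⟨m, hm, γ, hγ, T, hT, hTγ, R, hR, rfl⟩)
  · rw [map_sub, Finsupp.linearCombination_single, Finsupp.linearCombination_single, one_smul,
      one_smul]
    by_cases h : ∃ hI : Insertable n K T, Diagram.insert hD hK s hI ∈ 𝒟'
    · obtain ⟨hI, h⟩ := h
      have hI' := hI.of_isotopic hTT' hT'
      have hiso := hTT'.insert hD hK s hI hI' β.disjoint_boundary
      have h' := (hM.isotopy _ _ hiso).1 h
      rw [insertVector_of_mem hD hK s hI h, insertVector_of_mem hD hK s hI' h']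
      exact Submodule.subset_span (Or.inl ⟨_, h, _, h', hiso, rfl⟩)
    -- Both terms vanish together: if `T'` had an admissible insertion, the agreement of germs
    -- outside the disk would make `T` insertable, and closure under isotopy would make that
    -- insertion admissible.
    · push Not at h
      rw [insertVector_of_notMem hD hK s h, insertVector_of_notMem hD hK s, sub_zero]
      · exact Submodule.zero_mem _
      · intro hI' h'
        have hTT'' := hTT'
        obtain ⟨Φ, hΦ⟩ := hTT'
        by_cases hI : Insertable n K T
        · exact h hI ((hM.isotopy _ _ (hTT''.insert hD hK s hI hI' β.disjoint_boundary)).2 h')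
        · refine hI ⟨hT, fun p hp => ?_⟩
          rw [← hI'.fwd p hp, hΦ.fwd_eq_of_outside hp]
  · rw [map_sub, Finsupp.linearCombination_single, one_smul, map_finsuppSum]
    simp only [Finsupp.linearCombination_single]
    by_cases h : ∃ hI : Insertable n K T, Diagram.insert hD hK s hI ∈ 𝒟'
    · obtain ⟨hI, h⟩ := h
      have hI' : ∀ T' ∈ m.target.support, Insertable n K (R T') := fun T' hT' =>
        hI.of_replaces hγ (hR T' hT').2 (hR T' hT').1
      have hrep : ∀ T' (hT' : T' ∈ m.target.support), Replaces (β.comp γ) m.source T'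
          (Diagram.insert hD hK s hI) (Diagram.insert hD hK s (hI' T' hT')) := fun T' hT' =>
        (hR T' hT').2.insert hD hK s hI (hI' T' hT')
      have h' : ∀ T' (hT' : T' ∈ m.target.support),
          Diagram.insert hD hK s (hI' T' hT') ∈ 𝒟' := fun T' hT' =>
        (hM.move m hm _ _ _ T' hT' (hrep T' hT')).1 h
      refine Submodule.subset_span (Or.inr ⟨m, hm, β.comp γ,
        β.disjoint_boundary.mono_left (range_comp_subset β γ), _, h,
        Diagram.InDisk.insert hD hK s hI hTγ,
        -- Outside the support of the target the value is irrelevant; any diagram serves.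
        fun T' => if hT' : T' ∈ m.target.support then Diagram.insert hD hK s (hI' T' hT')
          else Diagram.insert hD hK s hI, fun T' hT' => ?_, ?_⟩)
      · simp only [dif_pos hT']
        exact ⟨h' T' hT', hrep T' hT'⟩
      · rw [insertVector_of_mem hD hK s hI h]
        congr 1
        refine Finset.sum_congr rfl fun T' hT' => ?_
        simp only [dif_pos hT']
        rw [insertVector_of_mem hD hK s (hI' T' hT') (h' T' hT'), Finsupp.smul_single_one]
    · push Not at h
      -- An admissible insertion of any target would, by undoing the move, give one of the source.
      -- So the whole relation is sent to zero.
      have hz : (m.target.sum fun T' a => a • insertVector hD hK s 𝒟' A (R T')) = 0 := by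
        refine Finset.sum_eq_zero fun T' hT' => ?_
        refine smul_eq_zero_of_right _ (insertVector_of_notMem hD hK s ?_)
        intro hI' h'
        have hI := hI'.of_replaces' hγ (hR T' hT').2 hT
        exact h hI ((hM.move m hm _ _ _ T' hT' ((hR T' hT').2.insert hD hK s hI hI')).2 h')
      rw [hz, insertVector_of_notMem hD hK s h, sub_zero]
      exact Submodule.zero_mem _

end Linear

/-- The functorial map in terms of the substitution inside a disk. -/
theorem replaceAll_eq_sum_insert {β : DiskChart I F} {K K' : PlaneDiagram true}
    {D D' : Diagram I F true} (hR : Replaces β K K' D D') {n : ℕ} (hK : K.IsTangle n)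
    (hK' : K'.IsTangle n) (hKK' : ∀ p, 1 < ‖p‖ → K.fwd p = K'.fwd p) {𝒟' : Set (Diagram I F o)}
    [Fintype (D.outerCrossings β)] [DecidableEq (D.outerCrossings β)]
    (v : Crossing I F → Tangle2Class o →₀ A) (hv : ∀ E ∈ (replaceAll D' v).support, E ∈ 𝒟')
    (v₀ : D.outerCrossings β → Tangle2Class o →₀ A) (hv₀ : ∀ c, v c.1 = v₀ c)
    (v' : Crossing 𝓘(ℝ, Plane) Plane → Tangle2Class o →₀ A)
    (hv' : ∀ k ∈ K'.crossings, v (k.push β) = v' k) :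
    replaceAll D' v = ∑ s ∈ Fintype.piFinset fun c => (v₀ c).support, (∏ c, v₀ c (s c)) •
      Finsupp.linearCombination A
        (insertVector hR.left hK (fun c => (s c).out) 𝒟' A) (replaceAll K' v') := by
  classical
  let _ : Fintype K'.crossings := K'.finite_crossings.fintype
  have hl : ∀ c, v (hR.crossingsEquiv (.inl c)).1 = v₀ c := hv₀
  have hr : ∀ k : K'.crossings, v (hR.crossingsEquiv (.inr k)).1 = v' k.1 := fun k => hv' k.1 k.2
  rw [replaceAll_eq_sum D' hR.crossingsEquiv v, sum_piFinset_sumElim]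
  simp only [hl, hr, Fintype.prod_sum_type, Sum.elim_inl, Sum.elim_inr]
  refine Finset.sum_congr rfl fun s _ => ?_
  rw [replaceAll_eq_sum K' (Equiv.refl _) v', map_sum, Finset.smul_sum]
  refine Finset.sum_congr rfl fun u _ => ?_
  rw [Finsupp.linearCombination_single, smul_smul]
  simp only [Equiv.refl_apply, Equiv.refl_symm]
  -- A nonzero total coefficient puts the diagram in the support, hence in `𝒟'`, so `insertVector`
  -- takes its nondefault value.
  by_cases h0 : (∏ c, v₀ c (s c)) * ∏ k : K'.crossings, v' k.1 (u k) = 0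
  · rw [h0, zero_smul, Finsupp.single_zero]
  · have h1 := hv _ (substitute_mem_support D' hR.crossingsEquiv v (Sum.elim s u)
      (by simpa only [hl, hr, Fintype.prod_sum_type, Sum.elim_inl, Sum.elim_inr] using h0))
    have h2 := insert_substitute hR hK hK' hKK' (fun c => ((s c).out : Tangle2 o))
      (fun k => (u k).out)
      (fun c => (Sum.elim s u (hR.crossingsEquiv.symm c)).out) (by
        rintro (c | k) <;> rw [Equiv.symm_apply_apply] <;> rfl)
    rw [← h2] at h1 ⊢
    rw [insertVector_of_mem hR.left hK _ _ h1, Finsupp.smul_single_one]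

/-- The functorial map is compatible with a replacement in a disk if it is so inside the disk. -/
theorem skeinEq_replaceAll_of_replaces {β : DiskChart I F} {K K' : PlaneDiagram true}
    {D D' : Diagram I F true} (hR : Replaces β K K' D D') {n : ℕ} (hK : K.IsTangle n)
    (hK' : K'.IsTangle n) (hKK' : ∀ p, 1 < ‖p‖ → K.fwd p = K'.fwd p) {𝒟' : Set (Diagram I F o)}
    {M : KnotTheory A o} (hM : M.IsOn 𝒟') {v v' : Crossing I F → Tangle2Class o →₀ A}
    (hv : ∀ E ∈ (replaceAll D v).support, E ∈ 𝒟')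
    (hv' : ∀ E ∈ (replaceAll D' v').support, E ∈ 𝒟')
    (hvv' : ∀ c ∈ D.crossings, Disjoint (range c.chart) (range β) → v c = v' c)
    {w w' : Crossing 𝓘(ℝ, Plane) Plane → Tangle2Class o →₀ A}
    (hw : ∀ k ∈ K.crossings, v (k.push β) = w k) (hw' : ∀ k ∈ K'.crossings, v' (k.push β) = w' k)
    (h : SkeinEq outside {T | T.IsTangle n} M (replaceAll K w) (replaceAll K' w')) :
    SkeinEq (I.boundary F) 𝒟' M (replaceAll D v) (replaceAll D' v') := by
  classical
  have := finite_outerCrossings D β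
  let _ : Fintype (D.outerCrossings β) := Fintype.ofFinite _
  rw [skeinEq_iff] at h ⊢
  -- Both expansions use the labels `v` on the outer crossings of `D`, which agree with `v'` there.
  -- The sums then run over the same choices with the same coefficients, and differ only in the
  -- vector that is inserted.
  rw [replaceAll_eq_sum_insert hR.left.replaces hK hK (fun _ _ => rfl) v hv (fun c => v c.1)
      (fun _ => rfl) w hw,
    replaceAll_eq_sum_insert hR hK hK' hKK' v' hv' (fun c => v c.1)
      (fun c => (hvv' c.1 c.2.1 c.2.2).symm) w' hw', ← Finset.sum_sub_distrib]
  refine Submodule.sum_mem _ fun s _ => ?_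
  rw [← smul_sub, ← map_sub]
  exact Submodule.smul_mem _ _ (linearCombination_insertVector_mem hR.left hK _ hM h)

/-- The functorial map is compatible with Reidemeister moves. -/
theorem MoveInstance.skeinEq {r : ReidemeisterMove} {D D' : Diagram I F true}
    (μ : MoveInstance r D D') {𝒟' : Set (Diagram I F o)} {M : KnotTheory A o} (hM : M.IsOn 𝒟')
    {v v' : Crossing I F → Tangle2Class o →₀ A}
    (hv : ∀ E ∈ (replaceAll D v).support, E ∈ 𝒟')
    (hv' : ∀ E ∈ (replaceAll D' v').support, E ∈ 𝒟')
    (away : ∀ c ∈ D.crossings, Disjoint (range c.chart) (range μ.disk) → v c = v' c)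
    (inside : ∀ j, v (μ.crossing (r.shape.corr j)) = v' (μ.crossing' j))
    (h : (fun i => v (μ.crossing i)) ∈ reidemeisterTuples r.shape M) :
    SkeinEq (I.boundary F) 𝒟' M (replaceAll D v) (replaceAll D' v') := by
  refine skeinEq_replaceAll_of_replaces μ.replaces μ.left_realizes.isTangle
    μ.right_realizes.isTangle μ.boundary hM hv hv' away ?_ ?_
    -- The condition in `reidemeisterTuples` ranges over all realizations of the shape, whatever
    -- their over/under data, so it applies to the tangles of `μ`.
    (h _ _ _ _ μ.left_realizes μ.right_realizes μ.boundary)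
  · intro k hk
    rw [μ.left_realizes.crossings] at hk
    obtain ⟨i, rfl⟩ := hk
    rw [μ.left_realizes.injective.extend_apply]
    rfl
  · intro k hk
    rw [μ.right_realizes.crossings] at hk
    obtain ⟨j, rfl⟩ := hk
    rw [μ.right_realizes.injective.extend_apply]
    exact (inside j).symm

end Expansion

end KnotDiagrams

/-! ### Invariance along the generated equivalence. -/

open KnotDiagrams in
theorem mainTheorem9
    {F : Type*} [TopologicalSpace F] [T2Space F] [CompactSpace F] [ConnectedSpace F]
    [ChartedSpace (EuclideanHalfSpace 2) F] [IsManifold (𝓡∂ 2) ∞ F] [OrientedSurface (𝓡∂ 2) F]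
    {A : Type*} [CommRing A]
    (S : Set ReidemeisterMove)
    (𝒟 : Set (Diagram (𝓡∂ 2) F true)) (h𝒟 : ∀ D ∈ 𝒟, D.IsClassical)
    (o : Bool) (M' : KnotTheory A o)
    (𝒟' : Set (Diagram (𝓡∂ 2) F o)) (hM' : M'.IsOn 𝒟')
    (τ : Diagram (𝓡∂ 2) F true → Crossing (𝓡∂ 2) F → Tangle2Class o →₀ A)
    (hτ : IsTrait 𝒟 S τ)
    (hval : ∀ D ∈ 𝒟, ∀ E ∈ (functorialMap τ D).support, E ∈ 𝒟')
    (h₁r : ∀ b, .omega1 true b ∈ S → ∀ D ∈ 𝒟, ∀ D' ∈ 𝒟,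
      ∀ μ : MoveInstance (.omega1 true b) D D', τ D (μ.crossing (0 : Fin 1)) ∈ Omega1r M')
    (h₁l : ∀ b, .omega1 false b ∈ S → ∀ D ∈ 𝒟, ∀ D' ∈ 𝒟,
      ∀ μ : MoveInstance (.omega1 false b) D D', τ D (μ.crossing (0 : Fin 1)) ∈ Omega1l M')
    (h₂ : ∀ kind b, .omega2 kind b ∈ S → ∀ D ∈ 𝒟, ∀ D' ∈ 𝒟,
      ∀ μ : MoveInstance (.omega2 kind b) D D',
        (τ D (μ.crossing (0 : Fin 2)), τ D (μ.crossing (1 : Fin 2))) ∈ Omega2 kind M')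
    (h₃ : ∀ d height, .omega3 d height ∈ S → ∀ D ∈ 𝒟, ∀ D' ∈ 𝒟,
      ∀ μ : MoveInstance (.omega3 d height) D D',
        (τ D (μ.crossing (0 : Fin 3)), τ D (μ.crossing (1 : Fin 3)), τ D (μ.crossing (2 : Fin 3)))
          ∈ Omega3 d M') :
    ∀ D₁ ∈ 𝒟, ∀ D₂ ∈ 𝒟, KnotEquiv 𝒟 S D₁ D₂ →
      SkeinEq ((𝓡∂ 2).boundary F) 𝒟' M' (functorialMap τ D₁) (functorialMap τ D₂) := by
  intro D₁ hD₁ D₂ hD₂ h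
  -- The generating relation already contains membership in `𝒟`. Keeping these hypotheses in the
  -- induction would demand it of the intermediate diagram in the transitive case.
  clear hD₁ hD₂
  induction h with
  | rel D D' h =>
    obtain ⟨hD, hD', ⟨Φ, hΦ⟩ | ⟨r, hr, ⟨μ⟩⟩⟩ := h
    · exact skeinEq_replaceAll_of_isotopic Φ hΦ (hτ.isotopy D hD D' hD' Φ hΦ) (hval D hD)
        (hval D' hD')
    · refine μ.skeinEq hM' (hval D hD) (hval D' hD') (hτ.away D hD D' hD' r hr μ)
        (hτ.inside D hD D' hD' r hr μ) ?_
      -- Once the kind of move is known, the crossing index is definitionally `Fin 1`, `Fin 2` or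
      -- `Fin 3`, and the tuple of labels is rewritten in the form used by the corresponding set.
      cases r with
      | omega1 right b =>
        have ht : (fun i => τ D (μ.crossing i)) = fun _ => τ D (μ.crossing (0 : Fin 1)) :=
          funext fun i : Fin 1 => by rw [Subsingleton.elim i 0]
        rw [ht]
        cases right
        · exact h₁l b hr D hD D' hD' μ
        · exact h₁r b hr D hD D' hD' μ
      | omega2 kind b =>
        have ht : (fun i => τ D (μ.crossing i)) =
            ![τ D (μ.crossing (0 : Fin 2)), τ D (μ.crossing (1 : Fin 2))] :=
          funext fun i : Fin 2 => by fin_cases i <;> rfl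
        rw [ht]
        exact h₂ kind b hr D hD D' hD' μ
      | omega3 d height =>
        have ht : (fun i => τ D (μ.crossing i)) = ![τ D (μ.crossing (0 : Fin 3)),
            τ D (μ.crossing (1 : Fin 3)), τ D (μ.crossing (2 : Fin 3))] :=
          funext fun i : Fin 3 => by fin_cases i <;> rfl
        rw [ht]
        exact h₃ d height hr D hD D' hD' μ
  | refl D => rfl
  | symm D D' _ ih => exact Eq.symm ih
  | trans D D' D'' _ _ ih ih' => exact Eq.trans ih ih'
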